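/- Let $n\ge 1$, let $u_1,\dots,u_n$ be the coordinates of $\mathbb{R}^n$, regarded as the big cell $\{u_0=1\}$ of $\mathbb{RP}^n$, and let $\xi_1,\dots,\xi_n$ be the conjugate momenta, so that $(u,\xi)$ are Darboux coordinates on $T^*\mathbb{R}^n$. Let $\mathcal{A}=\bigoplus_{d\ge 0}\mathcal{A}^d=C^\infty(\mathbb{R}^n,\mathbb{C})\otimes\mathbb{C}[\xi_1,\dots,\xi_n]$ be the algebra of smooth complex-valued functions on $T^*\mathbb{R}^n$ that are polynomial along the cotangent fibres, graded by the degree in $\xi$, with the Poisson bracket $$\{\phi,\psi\}=\sum_{i=1}^n\Big(\frac{\partial\phi}{\partial\xi_i}\frac{\partial\psi}{\partial u_i}-\frac{\partial\phi}{\partial u_i}\frac{\partial\psi}{\partial\xi_i}\Big).$$ For $\lambda\in\mathbb{C}$ let $\mathcal{B}^\lambda$ be the algebra of smooth linear differential operators (of finite order) on $\lambda$-densities on $\mathbb{R}^n$; trivializing the densities by $|du|^\lambda$, these are the operators $\sum_a f_a(u)\,\partial_u^a$. For $x\in\mathfrak{sl}_{n+1}(\mathbb{R})$ let $\eta^x=\sum_i\eta^x_i\,\partial_{u_i}$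 be the vector field on $\mathbb{R}^n$ given by the infinitesimal projective action of $x$, let $\mu^x=\sum_i\eta^x_i\,\xi_i\in\mathcal{A}^1$ be its principal symbol, and let $\eta^x_\lambda=\eta^x+\lambda\sum_i\partial_{u_i}\eta^x_i\in\mathcal{B}^\lambda$ be its Lie derivative on $\lambda$-densities. There is exactly one linear isomorphism $\mathcal{Q}_\lambda:\mathcal{A}\to\mathcal{B}^\lambda$ such that for every $\phi\in\mathcal{A}^d$ the operator $\mathcal{Q}_\lambda(\phi)$ has order at most $d$ with principal symbol $\phi$ in degree $d$, and such that $\mathcal{Q}_\lambda(\{\mu^x,\phi\})=[\eta^x_\lambda,\mathcal{Q}_\lambda(\phi)]$ for all $x\in\mathfrak{sl}_{n+1}(\mathbb{R})$ and $\phi\in\mathcal{A}$ (the Lecomte–Ovsienko quantization map). Let $\mathcal{Q}_{\lambda,t}:\mathcal{A}[t]\to\mathcal{B}^\lambda[t]$ be the $\mathbb{C}[t]$-linear map with $\mathcal{Q}_{\lambda,t}(\phi)=t^d\mathcal{Q}_\lambda(\phi)$ for $\phi\in\mathcal{A}^d$. For all $\phi,\psi\in\mathcal{A}$ there is exactly one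 element $\phi\star_\lambda\psi=\sum_{p\ge 0}C^\lambda_p(\phi,\psi)\,t^p$ of $\mathcal{A}[t]$ with $\mathcal{Q}_{\lambda,t}(\phi\star_\lambda\psi)=\mathcal{Q}_{\lambda,t}(\phi)\,\mathcal{Q}_{\lambda,t}(\psi)$. Call a map $B:\mathcal{A}\times\mathcal{A}\to\mathcal{A}$ bidifferential on $T^*\mathbb{R}^n$ if every point of $T^*\mathbb{R}^n$ has an open neighbourhood on which $B(\phi,\psi)=\sum_{(\alpha,\beta)}c_{\alpha\beta}\,\partial^\alpha\phi\;\partial^\beta\psi$ for all $\phi,\psi\in\mathcal{A}$, where the sum is finite, $\partial^\alpha,\partial^\beta$ are iterated partial derivatives in the coordinates $(u,\xi)$, and the $c_{\alpha\beta}$ are smooth functions that do not depend on $\phi$ and $\psi$. **Corollary.** For every $\lambda\in\mathbb{C}$ and every integer $p\ge 1$, the operator $C^\lambda_p$ is bidifferential on $T^*\mathbb{R}^n$ if and only if $\lambda=\tfrac12$ and $p=1$. In this exceptional case, $2\,C^{1/2}_1(\phi,\psi)=\{\phi,\psi\}$ for all $\phi,\psi\in\mathcal{A}$. -/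

import Mathlib

open scoped ContDiff

namespace LecomteOvsienko

/-- The algebra `C_∞[u]` of smooth complex-valued functions on `ℝⁿ`. -/
def Smooth (n : ℕ) : Subalgebra ℂ ((Fin n → ℝ) → ℂ) where
  carrier := {f | ContDiff ℝ ∞ f}
  mul_mem' {f g} hf hg := by
    have hf' : ContDiff ℝ ∞ f := hf
    have hg' : ContDiff ℝ ∞ g := hg
    exact hf'.mul hg'
  add_mem' {f g} hf hg := by
    have hf' : ContDiff ℝ ∞ f := hf
    have hg' : ContDiff ℝ ∞ g := hg
    exact hf'.add hg'
  algebraMap_mem' r := by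
    have h : ContDiff ℝ ∞ (fun _ : Fin n → ℝ => r) := contDiff_const
    exact h

theorem Smooth.contDiff {n : ℕ} (f : Smooth n) : ContDiff ℝ ∞ f.1 := f.2

theorem Smooth.differentiable {n : ℕ} (f : Smooth n) : Differentiable ℝ f.1 :=
  (Smooth.contDiff f).differentiable (by simp)

theorem Smooth.contDiff_partial {n : ℕ} (f : Smooth n) (i : Fin n) :
    ContDiff ℝ ∞ (fun u => fderiv ℝ f.1 u (Pi.single i 1)) :=
  ((Smooth.contDiff f).fderiv_right (m := ∞) (by simp)).clm_apply contDiff_const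

/-- The partial derivative `∂/∂u_i` acting on smooth functions on `ℝⁿ`. -/
noncomputable def partialU {n : ℕ} (i : Fin n) : Module.End ℂ (Smooth n) where
  toFun f := ⟨fun u => fderiv ℝ f.1 u (Pi.single i 1), Smooth.contDiff_partial f i⟩
  map_add' f g := by
    apply Subtype.ext
    funext u
    have h := fderiv_add (Smooth.differentiable f u) (Smooth.differentiable g u)
    exact congrArg (fun L => L (Pi.single i 1)) h
  map_smul' c f := by
    apply Subtype.ext
    funext u
    have h := fderiv_const_smul (Smooth.differentiable f u) c
    exact congrArg (fun L => L (Pi.single i 1)) h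

/-- The coordinate function `u_i` on `ℝⁿ`. -/
noncomputable def coord {n : ℕ} (i : Fin n) : Smooth n :=
  ⟨fun u => (u i : ℂ), by
    have h : ContDiff ℝ ∞ (fun u : Fin n → ℝ => (u i : ℂ)) :=
      Complex.ofRealCLM.contDiff.comp (contDiff_apply ℝ ℝ i)
    exact h⟩

/-! ### Symbols -/

/-- `Pol_∞(T*ℝⁿ) = C_∞[u] ⊗ ℂ[ξ]`, the algebra of smooth functions on `T*ℝⁿ` that are polynomial
along the fibres: polynomials in `ξ_1, …, ξ_n` whose coefficients are smooth functions of `u`.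
The piece of degree `d` consists of the homogeneous polynomials of degree `d`. -/
abbrev Pol (n : ℕ) : Type := MvPolynomial (Fin n) (Smooth n)

/-- The symbol `φ` as a function of the Darboux coordinates `(u, ξ)` of `T*ℝⁿ`. -/
noncomputable def Pol.toFunction {n : ℕ} (φ : Pol n) : (Fin n → ℝ) × (Fin n → ℝ) → ℂ :=
  fun z => ∑ a ∈ φ.support, (φ.coeff a).1 z.1 * ∏ i, (z.2 i : ℂ) ^ a i

/-- The derivative `∂/∂u_i` of a symbol (applied to every coefficient). The derivative `∂/∂ξ_i`
is `MvPolynomial.pderiv i`. -/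
noncomputable def Pol.partialU {n : ℕ} (i : Fin n) (φ : Pol n) : Pol n :=
  ∑ a ∈ φ.support, MvPolynomial.monomial a (LecomteOvsienko.partialU i (φ.coeff a))

/-- The Poisson bracket
`{φ, ψ} = ∑ i, (∂φ/∂ξ_i) (∂ψ/∂u_i) - (∂φ/∂u_i) (∂ψ/∂ξ_i)` (so that `{ξ_i, u_i} = 1`). -/
noncomputable def poisson {n : ℕ} (φ ψ : Pol n) : Pol n :=
  ∑ i, (MvPolynomial.pderiv i φ * Pol.partialU i ψ - Pol.partialU i φ * MvPolynomial.pderiv i ψ)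

/-! ### Differential operators

The density bundle of `ℝⁿ` is trivialized by `|du|`, so that differential operators on
`λ`-densities become differential operators on smooth functions; the dependence on `λ` is in the
Lie derivative `lieDensity`. -/

/-- The operator `∂^a = ∂_1^{a_1} ⋯ ∂_n^{a_n}`. -/
noncomputable def partialPow {n : ℕ} (a : Fin n →₀ ℕ) : Module.End ℂ (Smooth n) :=
  (List.ofFn fun i => partialU i ^ a i).prod

/-- The differential operator `∑ f_a ∂^a` with full (normally ordered) symbol `∑ f_a ξ^a`. -/
noncomputable def diffOp {n : ℕ} (φ : Pol n) : Module.End ℂ (Smooth n) :=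
  ∑ a ∈ φ.support, LinearMap.mulLeft ℂ (φ.coeff a) * partialPow a

/-- `P` is a differential operator of order at most `d` whose principal symbol in degree `d` is
`φ`: `P = ∑_{|a| = d} f_a ∂^a + (terms of order < d)` with `φ = ∑_{|a| = d} f_a ξ^a`. -/
def HasPrincipalSymbol {n : ℕ} (d : ℕ) (P : Module.End ℂ (Smooth n)) (φ : Pol n) : Prop :=
  φ.IsHomogeneous d ∧
    ∃ χ : Pol n, (∀ a ∈ χ.support, a.degree < d) ∧ P = diffOp (φ + χ)

/-! ### Vector fields -/

/-- The homogeneous coordinates `(u_0, u_1, …, u_n)`, `u_0 = 1`, on the big cell `ℝⁿ` of `ℝPⁿ`. -/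
noncomputable def homCoord {n : ℕ} : Fin (n + 1) → Smooth n :=
  Fin.cons 1 coord

/-- The components, on the big cell, of the vector field on `ℝPⁿ` generated by a matrix `x`, i.e.
the derivative at `t = 0` of the action of `exp (t x)` on the points `[1, u_1, …, u_n]`. -/
noncomputable def projField {n : ℕ} (x : Matrix (Fin (n + 1)) (Fin (n + 1)) ℝ) (i : Fin n) :
    Smooth n :=
  ∑ l, (x i.succ l : ℂ) • homCoord l - coord i * ∑ l, (x 0 l : ℂ) • homCoord l

/-- The principal symbol `∑ η_i ξ_i` of the vector field `η = ∑ η_i ∂_i`. -/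
noncomputable def momentum {n : ℕ} (η : Fin n → Smooth n) : Pol n :=
  ∑ i, MvPolynomial.C (η i) * MvPolynomial.X i

/-- The Lie derivative `∑ η_i ∂_i + l (∑ ∂_i η_i)` of `η = ∑ η_i ∂_i` on `l`-densities. -/
noncomputable def lieDensity {n : ℕ} (l : ℂ) (η : Fin n → Smooth n) : Module.End ℂ (Smooth n) :=
  ∑ i, LinearMap.mulLeft ℂ (η i) * partialU i
    + l • LinearMap.mulLeft ℂ (∑ i, partialU i (η i))

/-! ### The quantization map and the star product -/

/-- `Q` is an `sl_{n+1}(ℝ)`-equivariant quantization map from `Pol_∞(T*ℝⁿ)` to the differential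
operators on `l`-densities on `ℝⁿ`: a linear isomorphism that preserves principal symbols and
intertwines the actions `{μ^x, ·}` and `[η^x_l, ·]` of `sl_{n+1}(ℝ)`. -/
structure IsEquivariantQuantization (n : ℕ) (l : ℂ)
    (Q : Pol n →ₗ[ℂ] Module.End ℂ (Smooth n)) : Prop where
  injective : Function.Injective Q
  range_eq : Set.range Q = Set.range (diffOp (n := n))
  symbol : ∀ (d : ℕ) (φ : Pol n), φ.IsHomogeneous d → HasPrincipalSymbol d (Q φ) φ
  equivariant : ∀ x : Matrix (Fin (n + 1)) (Fin (n + 1)) ℝ, x.trace = 0 → ∀ φ : Pol n,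
    Q (poisson (momentum (projField x)) φ)
      = lieDensity l (projField x) * Q φ - Q φ * lieDensity l (projField x)

/-- The `ℂ[t]`-linear map `Q_t` from `Pol_∞(T*ℝⁿ)[t]` to polynomials in `t` with differential
operators as coefficients, with `Q_t(φ) = t^d Q(φ)` for `φ` homogeneous of degree `d`. -/
noncomputable def gradedQ {n : ℕ} (Q : Pol n →ₗ[ℂ] Module.End ℂ (Smooth n))
    (Φ : Polynomial (Pol n)) : Polynomial (Module.End ℂ (Smooth n)) :=
  ∑ k ∈ Φ.support, ∑ d ∈ Finset.range ((Φ.coeff k).totalDegree + 1),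
    Polynomial.monomial (k + d) (Q (MvPolynomial.homogeneousComponent d (Φ.coeff k)))

/-- The star product `φ ⋆ ψ = Q_t⁻¹(Q_t(φ) Q_t(ψ))` of two symbols. -/
noncomputable def starProduct {n : ℕ} (Q : Pol n →ₗ[ℂ] Module.End ℂ (Smooth n)) (φ ψ : Pol n) :
    Polynomial (Pol n) :=
  Function.invFun (gradedQ Q) (gradedQ Q (Polynomial.C φ) * gradedQ Q (Polynomial.C ψ))

/-- The coefficient `C_p(φ, ψ)` of `t^p` in `φ ⋆ ψ`. -/
noncomputable def starCoeff {n : ℕ} (Q : Pol n →ₗ[ℂ] Module.End ℂ (Smooth n)) (p : ℕ)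
    (φ ψ : Pol n) : Pol n :=
  (starProduct Q φ ψ).coeff p

/-! ### Bidifferential operators on `T*ℝⁿ` -/

/-- The coordinate directions of `T*ℝⁿ`: `inl i` is `∂/∂u_i`, `inr i` is `∂/∂ξ_i`. -/
def direction {n : ℕ} : Fin n ⊕ Fin n → (Fin n → ℝ) × (Fin n → ℝ)
  | Sum.inl i => (Pi.single i 1, 0)
  | Sum.inr i => (0, Pi.single i 1)

/-- The iterated partial derivative of a function on `T*ℝⁿ` along a list of coordinates. -/
noncomputable def iterPartial {n : ℕ} :
    List (Fin n ⊕ Fin n) → ((Fin n → ℝ) × (Fin n → ℝ) → ℂ) → (Fin n → ℝ) × (Fin n → ℝ) → ℂ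
  | [], F => F
  | s :: α, F => fun z => fderiv ℝ (iterPartial α F) z (direction s)

/-- `B` is (the restriction to `Pol_∞(T*ℝⁿ)` of) a bidifferential operator on `T*ℝⁿ`: locally on
`T*ℝⁿ`, `B(φ, ψ)` is a finite sum of terms `c · ∂^α φ · ∂^β ψ` with smooth coefficients `c`
that depend neither on `φ` nor on `ψ`. -/
def IsBidifferential {n : ℕ} (B : Pol n → Pol n → Pol n) : Prop :=
  ∀ z : (Fin n → ℝ) × (Fin n → ℝ), ∃ U : Set ((Fin n → ℝ) × (Fin n → ℝ)), IsOpen U ∧ z ∈ U ∧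
    ∃ (S : Finset (List (Fin n ⊕ Fin n) × List (Fin n ⊕ Fin n)))
      (c : List (Fin n ⊕ Fin n) × List (Fin n ⊕ Fin n) → (Fin n → ℝ) × (Fin n → ℝ) → ℂ),
      (∀ s ∈ S, ContDiffOn ℝ ∞ (c s) U) ∧
      ∀ φ ψ : Pol n, ∀ y ∈ U, (B φ ψ).toFunction y =
        ∑ s ∈ S, c s y * iterPartial s.1 φ.toFunction y * iterPartial s.2 ψ.toFunction y

end LecomteOvsienko

/-!
The operator `Op φ = ∑ f_a ∂^a` with symbol `φ = ∑ f_a ξ^a` intertwines the projective actions up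
to terms of lower degree. The Casimir element of `gl_{n+1}` acts on symbols of degree `d` by
`d (d + n)`, and these numbers are distinct, so an equivariant map that preserves principal symbols
is unique. It exists because the unipotent operator `S = ∑ c_k(d) Div^k` on symbols of degree `d`,
with `Div = ∑ ∂²/∂u_i∂ξ_i` and the coefficients `c_k(d)` solving the recursion imposed by the second
order vector fields, makes `Q = Op ∘ S⁻¹` equivariant.

Since `Op (u_i^p) * Op (ξ_i^d) = Op (u_i^p ξ_i^d)`, the coefficient `C_p (u_i^p, ξ_i^d)` is
`c_p(d) p! d (d - 1) ⋯ (d - p + 1) ξ_i^{d - p}`. If `C_p` is bidifferential, its value at `ξ = 1` is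
a polynomial in `d`, so the zeros `2 d = p + j - n`, `j < p`, of the denominator of `c_p(d)` are
zeros of its numerator. This forces `p = 1` and `l = 1 / 2`. For `l = 1 / 2` the coefficient
`c_1(d) = -1 / 2` does not depend on `d`, and symmetrizing the first order term `∑ ∂φ/∂ξ_i ∂ψ/∂u_i`
of the product of operators yields half of the Poisson bracket.
-/

namespace LecomteOvsienko

open MvPolynomial

/-! ### The degree filtration -/

section Degree

variable {σ K R M : Type*} [CommRing R]

/-- The filtration of polynomials by degree: `degreeLT σ R m` consists of the polynomials all of
whose terms have degree less than `m`, so that `degreeLT σ R 0` is trivial. -/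
noncomputable def degreeLT (σ R : Type*) [CommRing R] (m : ℕ) : Submodule R (MvPolynomial σ R) :=
  restrictSupport R {a | a.degree < m}

theorem mem_degreeLT_iff_support {m : ℕ} {φ : MvPolynomial σ R} :
    φ ∈ degreeLT σ R m ↔ ∀ a ∈ φ.support, a.degree < m :=
  mem_restrictSupport_iff R

theorem mem_degreeLT {m : ℕ} {φ : MvPolynomial σ R} :
    φ ∈ degreeLT σ R m ↔ ∀ a : σ →₀ ℕ, m ≤ a.degree → φ.coeff a = 0 := by
  simp only [mem_degreeLT_iff_support, mem_support_iff, ne_eq, ← not_lt, not_imp_comm]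

theorem degreeLT_mono {m k : ℕ} (h : m ≤ k) : degreeLT σ R m ≤ degreeLT σ R k :=
  restrictSupport_mono R fun _ ha => lt_of_lt_of_le ha h

theorem eq_zero_of_mem_degreeLT_zero {φ : MvPolynomial σ R} (h : φ ∈ degreeLT σ R 0) : φ = 0 := by
  ext1 a
  exact mem_degreeLT.1 h a (Nat.zero_le _)

theorem mem_degreeLT_of_isHomogeneous {d : ℕ} {φ : MvPolynomial σ R} (h : φ.IsHomogeneous d) :
    φ ∈ degreeLT σ R (d + 1) :=
  mem_degreeLT.2 fun _ ha => h.coeff_eq_zero (by omega)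

theorem mem_degreeLT_totalDegree_add_one (φ : MvPolynomial σ R) :
    φ ∈ degreeLT σ R (φ.totalDegree + 1) :=
  mem_degreeLT_iff_support.2 fun _ ha => Nat.lt_succ_of_le (le_totalDegree ha)

theorem pderiv_mem_degreeLT {m : ℕ} {φ : MvPolynomial σ R} (h : φ ∈ degreeLT σ R m) (i : σ) :
    pderiv i φ ∈ degreeLT σ R (m - 1) :=
  mem_degreeLT.2 fun a ha => by
    rw [coeff_pderiv,
      mem_degreeLT.1 h _ (by rw [map_add, Finsupp.degree_single]; omega), zero_mul]

theorem mul_mem_degreeLT {m k : ℕ} {φ ψ : MvPolynomial σ R}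
    (hφ : φ ∈ degreeLT σ R m) (hψ : ψ ∈ degreeLT σ R k) : φ * ψ ∈ degreeLT σ R (m + k - 1) := by
  classical
  refine mem_degreeLT_iff_support.2 fun c hc => ?_
  obtain ⟨a, ha, b, hb, rfl⟩ := Finset.mem_add.1 (support_mul φ ψ hc)
  have := mem_degreeLT_iff_support.1 hφ a ha
  have := mem_degreeLT_iff_support.1 hψ b hb
  rw [map_add]
  omega

theorem mul_mem_degreeLT_of_mem_degreeLT_sub_one {m k : ℕ} {φ ψ : MvPolynomial σ R}
    (hφ : φ ∈ degreeLT σ R (m - 1)) (hψ : ψ ∈ degreeLT σ R k) :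
    φ * ψ ∈ degreeLT σ R (m + k - 2) := by
  cases m with
  | zero => rw [eq_zero_of_mem_degreeLT_zero hφ, zero_mul]; exact Submodule.zero_mem _
  | succ m => exact degreeLT_mono (by omega) (mul_mem_degreeLT hφ hψ)

theorem pderiv_mul_isHomogeneous {a b : ℕ} {φ ψ : MvPolynomial σ R} (hφ : φ.IsHomogeneous a)
    (hψ : ψ.IsHomogeneous b) (i : σ) : (pderiv i φ * ψ).IsHomogeneous (a + b - 1) := by
  cases a with
  | zero =>
    rw [eq_zero_of_mem_degreeLT_zero (pderiv_mem_degreeLT (mem_degreeLT_of_isHomogeneous hφ) i),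
      zero_mul]
    exact isHomogeneous_zero σ R _
  | succ a =>
    rw [Nat.succ_add_sub_one]
    exact hφ.pderiv.mul hψ

theorem mem_degreeLT_of_mul_X_mem {m : ℕ} {φ : MvPolynomial σ R} {i : σ}
    (h : φ * X i ∈ degreeLT σ R (m + 1)) : φ ∈ degreeLT σ R m :=
  mem_degreeLT.2 fun a ha => by
    rw [← coeff_mul_X a i]
    exact mem_degreeLT.1 h _ (by rw [map_add, Finsupp.degree_single]; omega)

theorem homogeneousComponent_of_isHomogeneous {d : ℕ} {φ : MvPolynomial σ R}
    (h : φ.IsHomogeneous d) (k : ℕ) :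
    homogeneousComponent k φ = if k = d then φ else 0 := by
  rw [homogeneousComponent_of_mem h]

theorem homogeneousComponent_eq_zero_of_mem_degreeLT {m k : ℕ} {φ : MvPolynomial σ R}
    (h : φ ∈ degreeLT σ R m) (hk : m ≤ k) : homogeneousComponent k φ = 0 := by
  ext1 a
  rw [coeff_homogeneousComponent, coeff_zero]
  split_ifs with ha
  · exact mem_degreeLT.1 h a (by omega)
  · rfl

theorem sub_homogeneousComponent_mem_degreeLT {m : ℕ} {φ : MvPolynomial σ R}
    (h : φ ∈ degreeLT σ R (m + 1)) : φ - homogeneousComponent m φ ∈ degreeLT σ R m :=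
  mem_degreeLT.2 fun a ha => by
    rw [coeff_sub, coeff_homogeneousComponent]
    split_ifs with hm
    · exact sub_self _
    · rw [mem_degreeLT.1 h a (by omega), sub_zero]

theorem sum_homogeneousComponent_of_mem_degreeLT {m : ℕ} {φ : MvPolynomial σ R}
    (h : φ ∈ degreeLT σ R m) :
    ∑ d ∈ Finset.range m, homogeneousComponent d φ = φ := by
  ext1 a
  simp only [coeff_sum, coeff_homogeneousComponent, Finset.sum_ite_eq, Finset.mem_range]
  split_ifs with ha
  · rfl
  · exact (mem_degreeLT.1 h a (not_lt.1 ha)).symm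

variable [CommRing K] [Algebra K R] [AddCommGroup M] [Module K M]

theorem linearMap_ext_of_isHomogeneous {f g : MvPolynomial σ R →ₗ[K] M}
    (h : ∀ d φ, φ.IsHomogeneous d → f φ = g φ) : f = g := by
  refine LinearMap.ext fun φ => ?_
  rw [← sum_homogeneousComponent φ, map_sum, map_sum]
  exact Finset.sum_congr rfl fun d _ => h d _ (homogeneousComponent_isHomogeneous d φ)

theorem hasFiniteSupport_map_homogeneousComponent (T : ℕ → MvPolynomial σ R →ₗ[K] M)
    (φ : MvPolynomial σ R) :
    Function.HasFiniteSupport fun d => T d (homogeneousComponent d φ) :=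
  (Finset.range (φ.totalDegree + 1)).finite_toSet.subset fun d hd => by
    rw [Finset.coe_range, Set.mem_Iio, Nat.lt_succ_iff]
    contrapose! hd
    rw [Function.notMem_support, homogeneousComponent_eq_zero _ _ hd, map_zero]

/-- The linear map that agrees with `T d` on the homogeneous polynomials of degree `d`. -/
noncomputable def glueHomogeneous (T : ℕ → MvPolynomial σ R →ₗ[K] M) :
    MvPolynomial σ R →ₗ[K] M where
  toFun φ := ∑ᶠ d, T d (homogeneousComponent d φ)
  map_add' φ ψ := by
    simp only [map_add]
    exact finsum_add_distrib (hasFiniteSupport_map_homogeneousComponent T φ)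
      (hasFiniteSupport_map_homogeneousComponent T ψ)
  map_smul' c φ := by
    rw [RingHom.id_apply, smul_finsum' c (hasFiniteSupport_map_homogeneousComponent T φ)]
    simp only [LinearMap.map_smul_of_tower]

theorem glueHomogeneous_of_isHomogeneous (T : ℕ → MvPolynomial σ R →ₗ[K] M) {d : ℕ}
    {φ : MvPolynomial σ R} (h : φ.IsHomogeneous d) : glueHomogeneous T φ = T d φ := by
  refine (finsum_eq_single _ d fun k hk => ?_).trans ?_
  · rw [homogeneousComponent_of_isHomogeneous h, if_neg hk, map_zero]
  · rw [homogeneousComponent_of_isHomogeneous h, if_pos rfl]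

/-! ### Unipotent maps -/

/-- An endomorphism of polynomials is unipotent for the degree filtration if it only changes a
homogeneous polynomial by terms of smaller degree. -/
def IsUnipotent (S : Module.End K (MvPolynomial σ R)) : Prop :=
  ∀ d φ, φ.IsHomogeneous d → S φ - φ ∈ degreeLT σ R d

namespace IsUnipotent

variable {S : Module.End K (MvPolynomial σ R)}

theorem sub_mem_degreeLT (hS : IsUnipotent S) {m : ℕ} {φ : MvPolynomial σ R}
    (h : φ ∈ degreeLT σ R m) : S φ - φ ∈ degreeLT σ R (m - 1) := by
  induction m generalizing φ with
  | zero => simp [eq_zero_of_mem_degreeLT_zero h]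
  | succ m ih =>
    have htop := hS m _ (homogeneousComponent_isHomogeneous m φ)
    have hrest := degreeLT_mono m.pred_le (ih (sub_homogeneousComponent_mem_degreeLT h))
    have hsum := Submodule.add_mem _ htop hrest
    rwa [map_sub, sub_add_sub_comm, add_sub_cancel, add_sub_cancel] at hsum

theorem apply_mem_degreeLT (hS : IsUnipotent S) {m : ℕ} {φ : MvPolynomial σ R}
    (h : φ ∈ degreeLT σ R m) : S φ ∈ degreeLT σ R m := by
  have hsum := Submodule.add_mem _ (degreeLT_mono m.pred_le (hS.sub_mem_degreeLT h)) h
  rwa [sub_add_cancel] at hsum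

theorem mul {T : Module.End K (MvPolynomial σ R)} (hS : IsUnipotent S) (hT : IsUnipotent T) :
    IsUnipotent (S * T) := fun d φ hφ => by
  have hTφ := hT.apply_mem_degreeLT (mem_degreeLT_of_isHomogeneous hφ)
  have hsum := Submodule.add_mem _ (hS.sub_mem_degreeLT hTφ) (hT d φ hφ)
  rwa [sub_add_sub_cancel] at hsum

theorem injective (hS : IsUnipotent S) : Function.Injective S := by
  rw [injective_iff_map_eq_zero]
  intro φ hφ
  suffices ∀ m, φ ∈ degreeLT σ R m → φ = 0 from this _ (mem_degreeLT_totalDegree_add_one φ)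
  intro m hm
  induction m with
  | zero => exact eq_zero_of_mem_degreeLT_zero hm
  | succ m ih =>
    have := hS.sub_mem_degreeLT hm
    rw [hφ, zero_sub] at this
    exact ih (neg_mem_iff.1 this)

theorem exists_mem_degreeLT_apply_eq (hS : IsUnipotent S) {m : ℕ} {φ : MvPolynomial σ R}
    (h : φ ∈ degreeLT σ R m) : ∃ ψ ∈ degreeLT σ R m, S ψ = φ := by
  induction m generalizing φ with
  | zero => exact ⟨φ, h, by rw [eq_zero_of_mem_degreeLT_zero h, map_zero]⟩
  | succ m ih =>
    obtain ⟨ψ, hψ, e⟩ := ih (hS.sub_mem_degreeLT h)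
    refine ⟨φ - ψ, Submodule.sub_mem _ h (degreeLT_mono m.le_succ hψ), ?_⟩
    rw [map_sub, e, sub_sub_cancel]

theorem bijective (hS : IsUnipotent S) : Function.Bijective S :=
  ⟨hS.injective, fun φ =>
    (hS.exists_mem_degreeLT_apply_eq (mem_degreeLT_totalDegree_add_one φ)).imp fun _ h => h.2⟩

end IsUnipotent

end Degree

/-! ### The Euler operator -/

section Euler

theorem derivation_sum_apply {ι R A M : Type*} [CommSemiring R] [CommSemiring A] [AddCommMonoid M]
    [Algebra R A] [Module A M] [Module R M] (s : Finset ι) (D : ι → Derivation R A M) (a : A) :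
    (∑ i ∈ s, D i) a = ∑ i ∈ s, D i a :=
  (congrFun (map_sum Derivation.coeFnAddMonoidHom D s) a).trans (Finset.sum_apply a s _)

theorem pderiv_comm {σ R : Type*} [CommRing R] (i j : σ) (φ : MvPolynomial σ R) :
    pderiv i (pderiv j φ) = pderiv j (pderiv i φ) := by
  classical
  induction φ using MvPolynomial.induction_on with
  | C f => simp only [pderiv_C, map_zero]
  | add φ ψ hφ hψ => simp only [map_add, hφ, hψ]
  | mul_X φ k h =>
    simp only [Derivation.leibniz, map_add, smul_eq_mul, h, pderiv_X, Pi.single_apply, apply_ite,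
      map_zero, Derivation.map_one_eq_zero]
    split_ifs <;> ring

variable {σ R : Type*} [Fintype σ] [CommRing R]

/-- The Euler operator `∑ i, X i * ∂/∂X i`, whose eigenspaces are the homogeneous polynomials. -/
noncomputable def euler : Derivation R (MvPolynomial σ R) (MvPolynomial σ R) :=
  ∑ i, (X i : MvPolynomial σ R) • pderiv i

theorem euler_apply (φ : MvPolynomial σ R) : euler φ = ∑ i, X i * pderiv i φ := by
  simp only [euler, derivation_sum_apply, Derivation.smul_apply, smul_eq_mul]

theorem euler_C (f : R) : euler (C f : MvPolynomial σ R) = 0 := by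
  simp only [euler_apply, pderiv_C, mul_zero, Finset.sum_const_zero]

theorem euler_X (i : σ) : euler (X i : MvPolynomial σ R) = X i := by
  classical simp [euler_apply, pderiv_X, Pi.single_apply]

theorem euler_of_isHomogeneous {d : ℕ} {φ : MvPolynomial σ R} (h : φ.IsHomogeneous d) :
    euler φ = d • φ :=
  (euler_apply φ).trans h.sum_X_mul_pderiv

theorem coeff_euler (φ : MvPolynomial σ R) (a : σ →₀ ℕ) :
    (euler φ).coeff a = a.degree • φ.coeff a := by
  classical
  induction φ using MvPolynomial.induction_on' with
  | monomial b f =>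
    rw [euler_of_isHomogeneous (isHomogeneous_monomial f rfl), coeff_smul, coeff_monomial]
    split_ifs with h
    · rw [h]
    · rw [smul_zero, smul_zero]
  | add φ ψ hφ hψ => rw [map_add, coeff_add, coeff_add, hφ, hψ, smul_add]

theorem isHomogeneous_of_euler [IsAddTorsionFree R] {d : ℕ} {φ : MvPolynomial σ R}
    (h : euler φ = d • φ) : φ.IsHomogeneous d := by
  intro a ha
  have hcoeff := congrArg (coeff a) h
  rw [coeff_euler, coeff_smul, ← natCast_zsmul, ← natCast_zsmul] at hcoeff
  rw [← Nat.cast_injective (smul_left_injective ℤ ha hcoeff), Finsupp.degree_eq_weight_one]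
  rfl

theorem pderiv_euler (i : σ) (φ : MvPolynomial σ R) :
    pderiv i (euler φ) = pderiv i φ + euler (pderiv i φ) := by
  classical
  simp only [euler_apply, map_sum, Derivation.leibniz, pderiv_X, pderiv_comm i, smul_eq_mul,
    Finset.sum_add_distrib, Pi.single_apply, mul_ite, mul_one, mul_zero, Finset.sum_ite_eq',
    Finset.mem_univ, if_true]
  ring

end Euler

/-! ### Coordinates with commuting derivations -/

theorem coeff_sum_support_monomial {σ R : Type*} [CommRing R] (T : R →+ R)
    (φ : MvPolynomial σ R) (a : σ →₀ ℕ) :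
    (∑ b ∈ φ.support, monomial b (T (φ.coeff b))).coeff a = T (φ.coeff a) := by
  classical
  simp only [coeff_sum, coeff_monomial]
  rw [Finset.sum_ite_eq']
  split_ifs with h
  · rfl
  · rw [notMem_support_iff.1 h, map_zero]

/-- Functions `u_1, …, u_n` in a commutative algebra of functions, together with commuting
derivations `∂/∂u_1, …, ∂/∂u_n`. Symbols are polynomials in momenta `ξ_1, …, ξ_n` with
coefficients in this algebra. -/
structure CoordinateDerivations (K R : Type*) (n : ℕ) [CommRing K] [CommRing R]
    [Algebra K R] where
  coord : Fin n → R
  der : Fin n → Derivation K R R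
  der_comm (i j : Fin n) (f : R) : der i (der j f) = der j (der i f)
  der_coord (i j : Fin n) : der i (coord j) = if i = j then 1 else 0

namespace CoordinateDerivations

section Symbols

variable {K R : Type*} {n : ℕ} [CommRing K] [CommRing R] [Algebra K R]
  (D : CoordinateDerivations K R n)

/-- The derivative `∂/∂u_i` of symbols, acting on the coefficients. -/
noncomputable def symbolDer (i : Fin n) :
    Derivation K (MvPolynomial (Fin n) R) (MvPolynomial (Fin n) R) :=
  have hcoeff (φ : MvPolynomial (Fin n) R) (a : Fin n →₀ ℕ) :
      (∑ b ∈ φ.support, monomial b (D.der i (φ.coeff b))).coeff a = D.der i (φ.coeff a) :=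
    coeff_sum_support_monomial (D.der i : R →ₗ[K] R).toAddMonoidHom φ a
  Derivation.mk'
    { toFun φ := ∑ a ∈ φ.support, monomial a (D.der i (φ.coeff a))
      map_add' φ ψ := by
        ext1 a
        rw [hcoeff, coeff_add, coeff_add, hcoeff, hcoeff, map_add]
      map_smul' c φ := by
        ext1 a
        rw [hcoeff, RingHom.id_apply, coeff_smul, coeff_smul, hcoeff, Derivation.map_smul] }
    fun φ ψ => by
      classical
      ext1 a
      change coeff a (∑ b ∈ (φ * ψ).support, monomial b (D.der i ((φ * ψ).coeff b))) = _
      rw [hcoeff]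
      simp only [LinearMap.coe_mk, AddHom.coe_mk, smul_eq_mul, coeff_add, coeff_mul, hcoeff,
        map_sum, Derivation.leibniz, Finset.sum_add_distrib]
      congr 1
      exact Finset.sum_equiv (Equiv.prodComm _ _) (by simp [add_comm]) fun _ _ => rfl

theorem coeff_symbolDer (i : Fin n) (φ : MvPolynomial (Fin n) R) (a : Fin n →₀ ℕ) :
    (D.symbolDer i φ).coeff a = D.der i (φ.coeff a) :=
  coeff_sum_support_monomial (D.der i : R →ₗ[K] R).toAddMonoidHom φ a

theorem symbolDer_C (i : Fin n) (f : R) : D.symbolDer i (C f) = C (D.der i f) := by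
  classical
  ext1 a
  simp only [coeff_symbolDer, coeff_C, apply_ite (D.der i), map_zero]

theorem symbolDer_X (i j : Fin n) : D.symbolDer i (X j) = 0 := by
  classical
  ext1 a
  simp only [coeff_symbolDer, coeff_X, apply_ite (D.der i), Derivation.map_one_eq_zero, map_zero,
    ite_self, coeff_zero]

theorem symbolDer_comm (i j : Fin n) (φ : MvPolynomial (Fin n) R) :
    D.symbolDer i (D.symbolDer j φ) = D.symbolDer j (D.symbolDer i φ) := by
  ext1 a
  simp only [coeff_symbolDer, D.der_comm i]

theorem symbolDer_pderiv (i j : Fin n) (φ : MvPolynomial (Fin n) R) :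
    D.symbolDer i (pderiv j φ) = pderiv j (D.symbolDer i φ) := by
  ext1 a
  simp only [coeff_symbolDer, coeff_pderiv, Derivation.leibniz, ← Nat.cast_add_one,
    Derivation.map_natCast, smul_eq_mul]
  ring

theorem symbolDer_mem_degreeLT {m : ℕ} {φ : MvPolynomial (Fin n) R} (h : φ ∈ degreeLT (Fin n) R m)
    (i : Fin n) : D.symbolDer i φ ∈ degreeLT (Fin n) R m :=
  mem_degreeLT.2 fun a ha => by rw [coeff_symbolDer, mem_degreeLT.1 h a ha, map_zero]

/-! ### The projective action on symbols -/

/-- The homogeneous coordinates `(1, u_1, …, u_n)`. -/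
def homCoord : Fin (n + 1) → R :=
  Fin.cons 1 D.coord

/-- The momenta `(-∑ u_i ξ_i, ξ_1, …, ξ_n)` conjugate to the homogeneous coordinates. -/
noncomputable def homMomentum : Fin (n + 1) → MvPolynomial (Fin n) R :=
  Fin.cons (-∑ i, C (D.coord i) * X i) X

/-- The Poisson brackets `{ξ_k, ·}` with the momenta `homMomentum`. -/
noncomputable def homDer :
    Fin (n + 1) → Derivation K (MvPolynomial (Fin n) R) (MvPolynomial (Fin n) R) :=
  Fin.cons (euler.restrictScalars K -
    ∑ i, (C (D.coord i) : MvPolynomial (Fin n) R) • D.symbolDer i) D.symbolDer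

/-- The Poisson brackets `{·, u_l}` with the homogeneous coordinates. -/
noncomputable def homPderiv :
    Fin (n + 1) → Derivation R (MvPolynomial (Fin n) R) (MvPolynomial (Fin n) R) :=
  Fin.cons 0 pderiv

/-- The action of the matrix unit `E_{kl}` on symbols, which is the Poisson bracket with
`u_l ξ_k`. -/
noncomputable def glAction (k l : Fin (n + 1)) :
    Derivation K (MvPolynomial (Fin n) R) (MvPolynomial (Fin n) R) :=
  (C (D.homCoord l) : MvPolynomial (Fin n) R) • D.homDer k -
    D.homMomentum k • (homPderiv l).restrictScalars K

theorem glAction_apply (k l : Fin (n + 1)) (φ : MvPolynomial (Fin n) R) :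
    D.glAction k l φ = C (D.homCoord l) * D.homDer k φ - D.homMomentum k * homPderiv l φ := rfl

theorem homCoord_zero : D.homCoord 0 = 1 := rfl

theorem homCoord_succ (i : Fin n) : D.homCoord i.succ = D.coord i := rfl

theorem homMomentum_zero : D.homMomentum 0 = -∑ i, C (D.coord i) * X i := rfl

theorem homMomentum_succ (i : Fin n) : D.homMomentum i.succ = X i := rfl

theorem homDer_zero_apply (φ : MvPolynomial (Fin n) R) :
    D.homDer 0 φ = euler φ - ∑ i, C (D.coord i) * D.symbolDer i φ := by
  simp only [homDer, Fin.cons_zero, Derivation.sub_apply, Derivation.restrictScalars_apply,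
    derivation_sum_apply, Derivation.smul_apply, smul_eq_mul]

theorem homDer_succ (i : Fin n) : D.homDer i.succ = D.symbolDer i := rfl

theorem homPderiv_zero (φ : MvPolynomial (Fin n) R) : homPderiv 0 φ = 0 := rfl

theorem homPderiv_succ (i : Fin n) :
    homPderiv i.succ = pderiv (R := R) i := rfl

theorem symbolDer_coord (i j : Fin n) :
    D.symbolDer i (C (D.coord j)) = if i = j then 1 else 0 := by
  simp only [symbolDer_C, der_coord, apply_ite C, map_one, map_zero]

theorem homPderiv_C (l : Fin (n + 1)) (f : R) : homPderiv (n := n) l (C f) = 0 :=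
  Derivation.map_algebraMap _ f

theorem homDer_homCoord_zero (k : Fin (n + 1)) : D.homDer k (C (D.homCoord 0)) = 0 := by
  rw [homCoord_zero, map_one, Derivation.map_one_eq_zero]

theorem homDer_zero_coord (j : Fin n) : D.homDer 0 (C (D.coord j)) = -C (D.coord j) := by
  simp only [homDer_zero_apply, euler_C, symbolDer_coord, mul_ite, mul_one, mul_zero,
    Finset.sum_ite_eq', Finset.mem_univ, if_true, zero_sub]

theorem homDer_zero_X (j : Fin n) : D.homDer 0 (X j) = X j := by
  simp only [homDer_zero_apply, euler_X, symbolDer_X, mul_zero, Finset.sum_const_zero, sub_zero]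

theorem homDer_succ_homMomentum_zero (i : Fin n) :
    D.homDer i.succ (D.homMomentum 0) = -X i := by
  simp [homDer_succ, homMomentum_zero, symbolDer_X, symbolDer_coord]

theorem homDer_zero_homMomentum_zero : D.homDer 0 (D.homMomentum 0) = 0 := by
  simp only [homMomentum_zero, map_neg, map_sum, Derivation.leibniz, homDer_zero_X,
    homDer_zero_coord, smul_eq_mul]
  exact neg_eq_zero.2 (Finset.sum_eq_zero fun i _ => by ring)

theorem sum_homCoord_mul_homDer (φ : MvPolynomial (Fin n) R) :
    ∑ k, C (D.homCoord k) * D.homDer k φ = euler φ := by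
  simp only [Fin.sum_univ_succ, homCoord_zero, homDer_zero_apply, homCoord_succ, homDer_succ,
    map_one, one_mul, sub_add_cancel]

theorem sum_homCoord_mul_homMomentum : ∑ k, C (D.homCoord k) * D.homMomentum k = 0 := by
  simp only [Fin.sum_univ_succ, homCoord_zero, homMomentum_zero, homCoord_succ, homMomentum_succ,
    map_one, one_mul, neg_add_cancel]

theorem sum_homMomentum_mul_homPderiv (φ : MvPolynomial (Fin n) R) :
    ∑ k, D.homMomentum k * homPderiv k φ = euler φ := by
  simp only [Fin.sum_univ_succ, homPderiv_zero, homPderiv_succ, homMomentum_succ, euler_apply,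
    mul_zero, zero_add]

theorem sum_homDer_homCoord : ∑ k, D.homDer k (C (D.homCoord k)) = n := by
  simp [Fin.sum_univ_succ, homDer_homCoord_zero, homDer_succ, homCoord_succ, symbolDer_coord]

theorem sum_homPderiv_homMomentum : ∑ k, homPderiv k (D.homMomentum k) = n := by
  simp [Fin.sum_univ_succ, homPderiv_zero, homPderiv_succ, homMomentum_succ]

theorem sum_homCoord_mul_homDer_homMomentum (k : Fin (n + 1)) :
    ∑ l, C (D.homCoord l) * D.homDer k (D.homMomentum l) = -D.homMomentum k := by
  rw [Fin.sum_univ_succ]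
  cases k using Fin.cases with
  | zero =>
    simp only [homDer_zero_homMomentum_zero, homMomentum_succ, homDer_zero_X, homCoord_succ,
      mul_zero, zero_add]
    rw [homMomentum_zero, neg_neg]
  | succ i =>
    rw [homDer_succ_homMomentum_zero]
    simp only [homCoord_zero, homMomentum_succ, homDer_succ, symbolDer_X, map_one, one_mul,
      mul_zero, Finset.sum_const_zero, add_zero]

theorem euler_symbolDer (i : Fin n) (φ : MvPolynomial (Fin n) R) :
    euler (D.symbolDer i φ) = D.symbolDer i (euler φ) := by
  simp only [euler_apply, map_sum, Derivation.leibniz, symbolDer_X, symbolDer_pderiv, smul_eq_mul,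
    mul_zero, add_zero]

theorem euler_homDer (k : Fin (n + 1)) (φ : MvPolynomial (Fin n) R) :
    euler (D.homDer k φ) = D.homDer k (euler φ) := by
  cases k using Fin.cases with
  | zero =>
    simp only [homDer_zero_apply, map_sub, map_sum, Derivation.leibniz, euler_C, euler_symbolDer,
      smul_eq_mul, mul_zero, add_zero]
  | succ i => exact D.euler_symbolDer i φ

theorem homPderiv_euler (l : Fin (n + 1)) (φ : MvPolynomial (Fin n) R) :
    homPderiv l (euler φ) = homPderiv l φ + euler (homPderiv l φ) := by
  cases l using Fin.cases with
  | zero => simp only [homPderiv_zero, map_zero, add_zero]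
  | succ i => exact pderiv_euler i φ

theorem homPderiv_symbolDer (l : Fin (n + 1)) (i : Fin n) (φ : MvPolynomial (Fin n) R) :
    homPderiv l (D.symbolDer i φ) = D.symbolDer i (homPderiv l φ) := by
  cases l using Fin.cases with
  | zero => simp only [homPderiv_zero, map_zero]
  | succ j => exact (D.symbolDer_pderiv i j φ).symm

theorem homPderiv_homDer_zero (l : Fin (n + 1)) (φ : MvPolynomial (Fin n) R) :
    homPderiv l (D.homDer 0 φ) = D.homDer 0 (homPderiv l φ) + homPderiv l φ := by
  simp only [homDer_zero_apply, map_sub, map_sum, homPderiv_euler, Derivation.leibniz, homPderiv_C,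
    homPderiv_symbolDer, smul_eq_mul, mul_zero, add_zero]
  ring

theorem euler_homMomentum (k : Fin (n + 1)) : euler (D.homMomentum k) = D.homMomentum k := by
  cases k using Fin.cases with
  | zero => simp [homMomentum_zero, euler_X]
  | succ i => exact euler_X i

theorem euler_glAction (k l : Fin (n + 1)) (φ : MvPolynomial (Fin n) R) :
    euler (D.glAction k l φ) = D.glAction k l (euler φ) := by
  simp only [glAction_apply, map_sub, Derivation.leibniz, euler_homDer, homPderiv_euler,
    euler_homMomentum, euler_C, smul_eq_mul]
  ring

theorem sum_homMomentum_mul_euler_homPderiv (φ : MvPolynomial (Fin n) R) :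
    ∑ k, D.homMomentum k * euler (homPderiv k φ) = euler (euler φ) - euler φ := by
  simp only [eq_sub_iff_add_eq, ← D.sum_homMomentum_mul_homPderiv (euler φ), homPderiv_euler,
    mul_add, Finset.sum_add_distrib, D.sum_homMomentum_mul_homPderiv φ, add_comm]

theorem glAction_glAction (k l : Fin (n + 1)) (φ : MvPolynomial (Fin n) R) :
    D.glAction k l (D.glAction l k φ) =
      D.homDer k (C (D.homCoord k)) * (C (D.homCoord l) * D.homDer l φ)
        + C (D.homCoord l) * (C (D.homCoord k) * D.homDer k (D.homDer l φ))
        - C (D.homCoord l) * D.homDer k (D.homMomentum l) * homPderiv k φ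
        - C (D.homCoord l) * D.homMomentum l * D.homDer k (homPderiv k φ)
        - C (D.homCoord k) * D.homMomentum k * homPderiv l (D.homDer l φ)
        + D.homMomentum k * homPderiv k φ * homPderiv l (D.homMomentum l)
        + D.homMomentum k * (D.homMomentum l * homPderiv l (homPderiv k φ)) := by
  simp only [glAction_apply, map_sub, Derivation.leibniz, smul_eq_mul, homPderiv_C]
  ring

theorem casimir (φ : MvPolynomial (Fin n) R) :
    ∑ k, ∑ l, D.glAction k l (D.glAction l k φ) = 2 * (euler (euler φ) + n * euler φ) := by
  simp only [glAction_glAction, Finset.sum_add_distrib, Finset.sum_sub_distrib, ← Finset.mul_sum,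
    ← Finset.sum_mul, sum_homCoord_mul_homDer, sum_homCoord_mul_homMomentum, sum_homDer_homCoord,
    sum_homPderiv_homMomentum, sum_homCoord_mul_homDer_homMomentum, sum_homMomentum_mul_homPderiv]
  rw [Finset.sum_comm]
  simp only [← Finset.mul_sum, sum_homCoord_mul_homDer, euler_homDer, neg_mul,
    Finset.sum_neg_distrib, sum_homMomentum_mul_homPderiv, sum_homMomentum_mul_euler_homPderiv]
  ring

/-! ### The divergence operator -/

/-- The divergence `∑ ∂²/∂u_i∂ξ_i` of symbols. -/
noncomputable def divergence : Module.End K (MvPolynomial (Fin n) R) :=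
  ∑ i, (D.symbolDer i : Module.End K (MvPolynomial (Fin n) R)) *
    ((pderiv i).restrictScalars K : Derivation K _ (MvPolynomial (Fin n) R))

theorem divergence_apply (φ : MvPolynomial (Fin n) R) :
    D.divergence φ = ∑ i, D.symbolDer i (pderiv i φ) :=
  LinearMap.sum_apply _ _ _

theorem divergence_mul (φ ψ : MvPolynomial (Fin n) R) :
    D.divergence (φ * ψ) = φ * D.divergence ψ + ψ * D.divergence φ +
      ∑ i, (D.symbolDer i φ * pderiv i ψ + pderiv i φ * D.symbolDer i ψ) := by
  simp only [divergence_apply, Finset.mul_sum, ← Finset.sum_add_distrib]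
  refine Finset.sum_congr rfl fun i _ => ?_
  simp only [Derivation.leibniz, map_add, smul_eq_mul]
  ring

theorem sum_symbolDer_homCoord_mul_pderiv (l : Fin (n + 1)) (φ : MvPolynomial (Fin n) R) :
    ∑ i, D.symbolDer i (C (D.homCoord l)) * pderiv i φ = homPderiv l φ := by
  cases l using Fin.cases with
  | zero => simp [homCoord_zero, homPderiv_zero]
  | succ j => simp [homCoord_succ, symbolDer_coord, homPderiv_succ]

theorem divergence_homCoord_mul (l : Fin (n + 1)) (φ : MvPolynomial (Fin n) R) :
    D.divergence (C (D.homCoord l) * φ) = C (D.homCoord l) * D.divergence φ + homPderiv l φ := by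
  simp only [divergence_mul, divergence_apply (φ := C (D.homCoord l)), pderiv_C, map_zero,
    Finset.sum_const_zero, mul_zero, zero_mul, add_zero, sum_symbolDer_homCoord_mul_pderiv]

theorem divergence_X_mul (i : Fin n) (φ : MvPolynomial (Fin n) R) :
    D.divergence (X i * φ) = X i * D.divergence φ + D.symbolDer i φ := by
  classical
  simp [divergence_mul, divergence_apply (φ := X i), symbolDer_X, pderiv_X, Pi.single_apply,
    apply_ite (D.symbolDer _)]

theorem divergence_symbolDer (i : Fin n) (φ : MvPolynomial (Fin n) R) :
    D.divergence (D.symbolDer i φ) = D.symbolDer i (D.divergence φ) := by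
  simp only [divergence_apply, map_sum, ← symbolDer_pderiv, D.symbolDer_comm i]

theorem divergence_homPderiv (l : Fin (n + 1)) (φ : MvPolynomial (Fin n) R) :
    D.divergence (homPderiv l φ) = homPderiv l (D.divergence φ) := by
  cases l using Fin.cases with
  | zero => simp only [homPderiv_zero, map_zero]
  | succ i =>
    simp only [homPderiv_succ, divergence_apply, map_sum, ← symbolDer_pderiv, pderiv_comm i]

theorem divergence_euler (φ : MvPolynomial (Fin n) R) :
    D.divergence (euler φ) = euler (D.divergence φ) + D.divergence φ := by
  simp only [euler_apply, map_sum, divergence_X_mul, ← homPderiv_succ, divergence_homPderiv,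
    Finset.sum_add_distrib]
  simp only [homPderiv_succ, D.divergence_apply φ]

theorem divergence_homDer (k : Fin (n + 1)) (φ : MvPolynomial (Fin n) R) :
    D.divergence (D.homDer k φ) = D.homDer k (D.divergence φ) := by
  cases k using Fin.cases with
  | zero =>
    simp only [homDer_zero_apply, map_sub, map_sum, ← homCoord_succ, divergence_homCoord_mul,
      divergence_symbolDer, divergence_euler, Finset.sum_add_distrib, homPderiv_succ,
      ← symbolDer_pderiv, ← divergence_apply]
    ring
  | succ i => exact D.divergence_symbolDer i φ

theorem divergence_homMomentum_zero_mul (φ : MvPolynomial (Fin n) R) :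
    D.divergence (D.homMomentum 0 * φ) =
      D.homMomentum 0 * D.divergence φ + D.homDer 0 φ - 2 * euler φ - n * φ := by
  have hterm (i : Fin n) : D.divergence (C (D.coord i) * (X i * φ)) =
      C (D.coord i) * (X i * D.divergence φ) + C (D.coord i) * D.symbolDer i φ
        + (φ + X i * pderiv i φ) := by
    simp only [← homCoord_succ, divergence_homCoord_mul, divergence_X_mul, homPderiv_succ,
      Derivation.leibniz, pderiv_X_self, smul_eq_mul]
    ring
  simp only [homMomentum_zero, neg_mul, map_neg, Finset.sum_mul, map_sum, mul_assoc, hterm,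
    Finset.sum_add_distrib, ← euler_apply, homDer_zero_apply, Finset.sum_const, Finset.card_univ,
    Fintype.card_fin, nsmul_eq_mul]
  ring

theorem divergence_glAction_succ (i : Fin n) (l : Fin (n + 1)) (φ : MvPolynomial (Fin n) R) :
    D.divergence (D.glAction i.succ l φ) = D.glAction i.succ l (D.divergence φ) := by
  simp only [glAction_apply, map_sub, divergence_homCoord_mul, homMomentum_succ, homDer_succ,
    divergence_X_mul, divergence_homPderiv, divergence_symbolDer, homPderiv_symbolDer]
  ring

theorem divergence_glAction_zero (l : Fin (n + 1)) (φ : MvPolynomial (Fin n) R) :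
    D.divergence (D.glAction 0 l φ) =
      D.glAction 0 l (D.divergence φ) + (2 * euler (homPderiv l φ) + (n + 1) * homPderiv l φ) := by
  simp only [glAction_apply, map_sub, divergence_homCoord_mul, divergence_homDer,
    divergence_homMomentum_zero_mul, divergence_homPderiv, homPderiv_homDer_zero]
  ring

theorem divergence_pow_homPderiv (m : ℕ) (l : Fin (n + 1)) (φ : MvPolynomial (Fin n) R) :
    (D.divergence ^ m) (homPderiv l φ) = homPderiv l ((D.divergence ^ m) φ) := by
  induction m with
  | zero => rfl
  | succ m ih => simp only [pow_succ', Module.End.mul_apply, ih, divergence_homPderiv]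

theorem divergence_pow_glAction_succ (m : ℕ) (i : Fin n) (l : Fin (n + 1))
    (φ : MvPolynomial (Fin n) R) :
    (D.divergence ^ m) (D.glAction i.succ l φ) = D.glAction i.succ l ((D.divergence ^ m) φ) := by
  induction m with
  | zero => rfl
  | succ m ih => simp only [pow_succ', Module.End.mul_apply, ih, divergence_glAction_succ]

theorem divergence_mem_degreeLT {m : ℕ} {φ : MvPolynomial (Fin n) R}
    (h : φ ∈ degreeLT (Fin n) R m) : D.divergence φ ∈ degreeLT (Fin n) R (m - 1) := by
  rw [divergence_apply]
  exact Submodule.sum_mem _ fun i _ => D.symbolDer_mem_degreeLT (pderiv_mem_degreeLT h i) i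

theorem divergence_pow_mem_degreeLT {m : ℕ} {φ : MvPolynomial (Fin n) R}
    (h : φ ∈ degreeLT (Fin n) R m) (k : ℕ) :
    (D.divergence ^ k) φ ∈ degreeLT (Fin n) R (m - k) := by
  induction k with
  | zero => exact h
  | succ k ih =>
    rw [pow_succ', Module.End.mul_apply, ← Nat.sub_sub]
    exact D.divergence_mem_degreeLT ih

end Symbols

section Spectrum

variable {K R : Type*} {n : ℕ} [CommRing K] [CommRing R] [Algebra K R]
  (D : CoordinateDerivations K R n)

theorem glAction_isHomogeneous [IsAddTorsionFree R] {d : ℕ} {φ : MvPolynomial (Fin n) R}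
    (h : φ.IsHomogeneous d) (k l : Fin (n + 1)) : (D.glAction k l φ).IsHomogeneous d :=
  isHomogeneous_of_euler <| by rw [euler_glAction, euler_of_isHomogeneous h, map_nsmul]

theorem homPderiv_isHomogeneous {d : ℕ} {φ : MvPolynomial (Fin n) R} (h : φ.IsHomogeneous d)
    (l : Fin (n + 1)) : (homPderiv l φ).IsHomogeneous (d - 1) := by
  cases l using Fin.cases with
  | zero => exact isHomogeneous_zero _ _ _
  | succ i => exact h.pderiv

theorem homPderiv_of_isHomogeneous_zero {φ : MvPolynomial (Fin n) R} (h : φ.IsHomogeneous 0)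
    (l : Fin (n + 1)) : homPderiv l φ = 0 := by
  rw [totalDegree_eq_zero_iff_eq_C.1 ((totalDegree_zero_iff_isHomogeneous _).2 h), homPderiv_C]

theorem casimir_of_isHomogeneous {d : ℕ} {φ : MvPolynomial (Fin n) R} (h : φ.IsHomogeneous d) :
    ∑ k, ∑ l, D.glAction k l (D.glAction l k φ) = (2 * (d * (d + n))) • φ := by
  rw [casimir, euler_of_isHomogeneous h, map_nsmul, euler_of_isHomogeneous h]
  simp only [nsmul_eq_mul]
  push_cast
  ring

theorem coeff_casimir (φ : MvPolynomial (Fin n) R) (a : Fin n →₀ ℕ) :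
    (∑ k, ∑ l, D.glAction k l (D.glAction l k φ)).coeff a =
      (2 * (a.degree * (a.degree + n))) • φ.coeff a := by
  have hcasimir : (2 : MvPolynomial (Fin n) R) * (euler (euler φ) + n * euler φ) =
      2 • (euler (euler φ) + n • euler φ) := by simp only [nsmul_eq_mul, Nat.cast_ofNat]
  rw [casimir, hcasimir]
  simp only [coeff_smul, coeff_add, coeff_euler, smul_smul, ← add_smul]
  congr 1
  ring

theorem eq_one_of_commute_glAction [IsAddTorsionFree R]
    {S : Module.End K (MvPolynomial (Fin n) R)} (hS : IsUnipotent S)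
    (hcomm : ∀ k l φ, S (D.glAction k l φ) = D.glAction k l (S φ)) : S = 1 := by
  refine linearMap_ext_of_isHomogeneous fun d φ hφ => ?_
  ext1 a
  rw [Module.End.one_apply]
  by_cases ha : a.degree < d
  · have hcasimir : ∑ k, ∑ l, D.glAction k l (D.glAction l k (S φ)) =
        (2 * (d * (d + n))) • S φ := by
      simp only [← hcomm, ← map_sum, casimir_of_isHomogeneous D hφ, map_nsmul]
    have hcoeff := congrArg (coeff a) hcasimir
    rw [coeff_casimir, coeff_smul, ← natCast_zsmul, ← natCast_zsmul] at hcoeff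
    have hne : 2 * (a.degree * (a.degree + n)) ≠ 2 * (d * (d + n)) := by nlinarith
    rw [hφ.coeff_eq_zero ha.ne]
    by_contra h0
    exact hne (Nat.cast_injective (smul_left_injective ℤ h0 hcoeff))
  · have htop := mem_degreeLT.1 (hS d φ hφ) a (not_lt.1 ha)
    rwa [coeff_sub, sub_eq_zero] at htop

theorem euler_homPderiv_of_eigen {φ : MvPolynomial (Fin n) R} {z : K} (h : euler φ = z • φ)
    (l : Fin (n + 1)) : euler (homPderiv l φ) = (z - 1) • homPderiv l φ := by
  rw [sub_smul, one_smul, eq_sub_iff_add_eq', ← homPderiv_euler, h, Derivation.map_smul_of_tower]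

theorem euler_divergence_of_eigen {φ : MvPolynomial (Fin n) R} {z : K} (h : euler φ = z • φ) :
    euler (D.divergence φ) = (z - 1) • D.divergence φ := by
  rw [sub_smul, one_smul, eq_sub_iff_add_eq, ← divergence_euler, h, map_smul]

theorem euler_divergence_pow_of_eigen {φ : MvPolynomial (Fin n) R} {z : K} (h : euler φ = z • φ)
    (m : ℕ) : euler ((D.divergence ^ m) φ) = (z - m) • (D.divergence ^ m) φ := by
  induction m with
  | zero => simpa using h
  | succ m ih =>
    rw [pow_succ', Module.End.mul_apply, D.euler_divergence_of_eigen ih, Nat.cast_succ, sub_sub]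

theorem divergence_glAction_zero_of_eigen {φ : MvPolynomial (Fin n) R} {z : K}
    (h : euler φ = z • φ) (l : Fin (n + 1)) :
    D.divergence (D.glAction 0 l φ) =
      D.glAction 0 l (D.divergence φ) + (2 * z + n - 1) • homPderiv l φ := by
  rw [divergence_glAction_zero, euler_homPderiv_of_eigen h]
  simp only [Algebra.smul_def, map_sub, map_add, map_mul, map_ofNat, map_natCast, map_one]
  ring

theorem divergence_pow_glAction_zero_of_eigen (m : ℕ) (l : Fin (n + 1))
    {φ : MvPolynomial (Fin n) R} {z : K} (h : euler φ = z • φ) :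
    (D.divergence ^ m) (D.glAction 0 l φ) = D.glAction 0 l ((D.divergence ^ m) φ) +
      (m * (2 * z - m + n)) • (D.divergence ^ (m - 1)) (homPderiv l φ) := by
  induction m with
  | zero => simp
  | succ m ih =>
    have hpow : ((m : K) * (2 * z - m + n)) •
        D.divergence ((D.divergence ^ (m - 1)) (homPderiv l φ)) =
          ((m : K) * (2 * z - m + n)) • (D.divergence ^ m) (homPderiv l φ) := by
      cases m with
      | zero => simp only [Nat.cast_zero, zero_mul, zero_smul]
      | succ m => rw [Nat.add_sub_cancel, pow_succ' _ m, Module.End.mul_apply]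
    rw [pow_succ', Module.End.mul_apply, Module.End.mul_apply, ih, map_add, map_smul, hpow,
      D.divergence_glAction_zero_of_eigen (D.euler_divergence_pow_of_eigen h m),
      ← divergence_pow_homPderiv, add_assoc, ← add_smul, Nat.add_sub_cancel]
    congr 2
    push_cast
    ring

/-- The commutator of an operator with the Lie derivative of the matrix unit `E_{kj}` on
`l`-densities, on the level of normally ordered symbols. -/
noncomputable def densityAction (l : K) (k j : Fin (n + 1)) :
    Module.End K (MvPolynomial (Fin n) R) :=
  (D.glAction k j : Module.End K (MvPolynomial (Fin n) R)) +
    if k = 0 then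
      ((euler.restrictScalars K : Derivation K (MvPolynomial (Fin n) R) _).toLinearMap +
        (l * (n + 1)) • 1) ∘ₗ ((homPderiv j).restrictScalars K : Derivation K _ _).toLinearMap
    else 0

theorem densityAction_zero_apply (l : K) (j : Fin (n + 1)) (φ : MvPolynomial (Fin n) R) :
    D.densityAction l 0 j φ =
      D.glAction 0 j φ + (euler (homPderiv j φ) + (l * (n + 1)) • homPderiv j φ) := rfl

theorem densityAction_succ_apply (l : K) (i : Fin n) (j : Fin (n + 1))
    (φ : MvPolynomial (Fin n) R) : D.densityAction l i.succ j φ = D.glAction i.succ j φ := by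
  rw [densityAction, if_neg i.succ_ne_zero, add_zero]
  rfl

end Spectrum

/-! ### The symbol map -/

section SymbolMap

variable {K R : Type*} {n : ℕ} [Field K] [CommRing R] [Algebra K R]
  (D : CoordinateDerivations K R n)

/-- The coefficient of the `k`-th power of the divergence in `symbolMap` on symbols of degree `z`.
The degree is allowed to be a scalar because the coefficient is a rational function of it. -/
noncomputable def symbolCoeff (n : ℕ) (l : K) (k : ℕ) (z : K) : K :=
  (-1) ^ k / (k.factorial : K) *
    ∏ i ∈ Finset.range k, (z - 1 - i + l * (n + 1)) / (2 * z - k - i + n)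

theorem symbolCoeff_zero (l z : K) : symbolCoeff n l 0 z = 1 := by simp [symbolCoeff]

theorem symbolCoeff_succ [CharZero K] (l : K) (k : ℕ) {z : K}
    (hz : 2 * z - (k + 1 : ℕ) + n ≠ 0) :
    symbolCoeff n l (k + 1) z * ((k + 1 : ℕ) * (2 * z - (k + 1 : ℕ) + n)) =
      -((z - 1 + l * (n + 1)) * symbolCoeff n l k (z - 1)) := by
  have hshift : ∏ i ∈ Finset.range k, (z - 1 - (i + 1 : ℕ) + l * (n + 1)) /
        (2 * z - (k + 1 : ℕ) - (i + 1 : ℕ) + n) =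
      ∏ i ∈ Finset.range k, (z - 1 - 1 - i + l * (n + 1)) / (2 * (z - 1) - k - i + n) := by
    refine Finset.prod_congr rfl fun i _ => ?_
    push_cast
    congr 1 <;> ring
  have hk : ((k + 1 : ℕ) : K) ≠ 0 := Nat.cast_ne_zero.2 k.succ_ne_zero
  have hfactorial : (k.factorial : K) ≠ 0 := Nat.cast_ne_zero.2 k.factorial_ne_zero
  rw [symbolCoeff, symbolCoeff, Finset.prod_range_succ', hshift, Nat.factorial_succ]
  generalize ∏ i ∈ Finset.range k,
    (z - 1 - 1 - i + l * (n + 1)) / (2 * (z - 1) - k - i + n) = P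
  simp only [Nat.cast_mul, Nat.cast_zero, sub_zero]
  generalize 2 * z - ((k + 1 : ℕ) : K) + n = w at *
  generalize ((k + 1 : ℕ) : K) = c at *
  field_simp
  ring

/-- The projectively equivariant symbol of the operator with a given normally ordered symbol. It
is the inverse of the quantization map on the level of symbols. -/
noncomputable def symbolMap (l : K) : Module.End K (MvPolynomial (Fin n) R) :=
  glueHomogeneous fun d => ∑ k ∈ Finset.range (d + 1), symbolCoeff n l k d • D.divergence ^ k

theorem symbolMap_of_isHomogeneous (l : K) {φ : MvPolynomial (Fin n) R} {d : ℕ}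
    (h : φ.IsHomogeneous d) : D.symbolMap l φ =
      ∑ k ∈ Finset.range (d + 1), symbolCoeff n l k d • (D.divergence ^ k) φ := by
  rw [symbolMap, glueHomogeneous_of_isHomogeneous _ h]
  simp only [LinearMap.sum_apply, LinearMap.smul_apply]

theorem symbolMap_of_isHomogeneous_zero (l : K) {φ : MvPolynomial (Fin n) R}
    (h : φ.IsHomogeneous 0) : D.symbolMap l φ = φ := by
  rw [symbolMap_of_isHomogeneous D l h, zero_add, Finset.sum_range_one, symbolCoeff_zero,
    one_smul, pow_zero, Module.End.one_apply]

theorem isUnipotent_symbolMap (l : K) : IsUnipotent (D.symbolMap l) := fun d φ h => by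
  rw [D.symbolMap_of_isHomogeneous l h, Finset.sum_range_succ', symbolCoeff_zero, pow_zero,
    one_smul, Module.End.one_apply, add_sub_cancel_right]
  refine Submodule.sum_mem _ fun k _ => Submodule.smul_of_tower_mem _ _ ?_
  exact degreeLT_mono (by omega)
    (D.divergence_pow_mem_degreeLT (mem_degreeLT_of_isHomogeneous h) (k + 1))

theorem symbolCoeff_succ_of_lt [CharZero K] (l : K) {d m : ℕ} (hm : m < d + 1) :
    symbolCoeff n l (m + 1) (d + 1 : ℕ) *
        ((m + 1 : ℕ) * (2 * (d + 1 : ℕ) - (m + 1 : ℕ) + n)) =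
      -((d + l * (n + 1)) * symbolCoeff n l m d) := by
  have hden : 2 * ((d + 1 : ℕ) : K) - (m + 1 : ℕ) + n = ((d - m + d + 1 + n : ℕ) : K) := by
    push_cast [Nat.cast_sub (by omega : m ≤ d)]
    ring
  have hpos : ((d - m + d + 1 + n : ℕ) : K) ≠ 0 := Nat.cast_ne_zero.2 (by omega)
  rw [symbolCoeff_succ l m (hden ▸ hpos), Nat.cast_succ d, add_sub_cancel_right]

theorem symbolMap_glAction_zero [CharZero K] (l : K) (j : Fin (n + 1)) {d : ℕ}
    {φ : MvPolynomial (Fin n) R} (h : φ.IsHomogeneous (d + 1)) :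
    D.symbolMap l (D.glAction 0 j φ) =
      D.glAction 0 j (D.symbolMap l φ) - (d + l * (n + 1)) • D.symbolMap l (homPderiv j φ) := by
  have := IsAddTorsionFree.of_isTorsionFree K R
  have heuler : euler φ = ((d + 1 : ℕ) : K) • φ := by
    rw [Nat.cast_smul_eq_nsmul, euler_of_isHomogeneous h]
  rw [D.symbolMap_of_isHomogeneous l (D.glAction_isHomogeneous h 0 j),
    D.symbolMap_of_isHomogeneous l h,
    D.symbolMap_of_isHomogeneous l (homPderiv_isHomogeneous h j), map_sum]
  simp only [D.divergence_pow_glAction_zero_of_eigen _ j heuler, smul_add,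
    Finset.sum_add_distrib, Derivation.map_smul, smul_smul, Finset.smul_sum]
  rw [sub_eq_add_neg, add_right_inj, Finset.sum_range_succ', ← Finset.sum_neg_distrib]
  simp only [Nat.cast_zero, zero_mul, mul_zero, zero_smul, add_zero, Nat.add_sub_cancel,
    ← neg_smul]
  exact Finset.sum_congr rfl fun m hm => by
    rw [symbolCoeff_succ_of_lt l (Finset.mem_range.1 hm)]

theorem symbolMap_densityAction [CharZero K] (l : K) (k j : Fin (n + 1))
    (φ : MvPolynomial (Fin n) R) :
    D.symbolMap l (D.densityAction l k j φ) = D.glAction k j (D.symbolMap l φ) := by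
  have := IsAddTorsionFree.of_isTorsionFree K R
  suffices D.symbolMap l * D.densityAction l k j =
      (D.glAction k j : Module.End K (MvPolynomial (Fin n) R)) * D.symbolMap l from
    LinearMap.congr_fun this φ
  refine linearMap_ext_of_isHomogeneous fun d φ hφ => ?_
  simp only [Module.End.mul_apply, Derivation.coeFn_coe]
  cases k using Fin.cases with
  | zero =>
    cases d with
    | zero =>
      rw [densityAction_zero_apply, homPderiv_of_isHomogeneous_zero hφ, map_zero, smul_zero,
        add_zero, add_zero, D.symbolMap_of_isHomogeneous_zero l hφ,
        D.symbolMap_of_isHomogeneous_zero l (D.glAction_isHomogeneous hφ 0 j)]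
    | succ d =>
      rw [densityAction_zero_apply, euler_of_isHomogeneous (homPderiv_isHomogeneous hφ j),
        Nat.add_sub_cancel, ← Nat.cast_smul_eq_nsmul K, ← add_smul, map_add, map_smul,
        D.symbolMap_glAction_zero l j hφ, sub_add_cancel]
  | succ i =>
    rw [densityAction_succ_apply, D.symbolMap_of_isHomogeneous l hφ,
      D.symbolMap_of_isHomogeneous l (D.glAction_isHomogeneous hφ i.succ j), map_sum]
    simp only [divergence_pow_glAction_succ, Derivation.map_smul]

end SymbolMap

/-! ### Operators and their normally ordered symbols -/

theorem list_prod_ofFn_eq_mul {M : Type*} [Monoid M] {n : ℕ} {f g : Fin n → M} {x : M} (j : Fin n)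
    (hj : g j = f j * x) (hne : ∀ i, i ≠ j → g i = f i) (hx : ∀ i, Commute x (f i)) :
    (List.ofFn g).prod = (List.ofFn f).prod * x := by
  induction n with
  | zero => exact j.elim0
  | succ n ih =>
    rw [List.ofFn_succ, List.ofFn_succ, List.prod_cons, List.prod_cons]
    cases j using Fin.cases with
    | zero =>
      have htail : (fun i : Fin n => g i.succ) = fun i => f i.succ :=
        funext fun i => hne _ i.succ_ne_zero
      have hcomm : Commute x (List.ofFn fun i : Fin n => f i.succ).prod :=
        Commute.list_prod_right _ _ fun y hy => by
          obtain ⟨i, rfl⟩ := List.mem_ofFn.1 hy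
          exact hx _
      rw [htail, hj, mul_assoc, mul_assoc, hcomm.eq]
    | succ j =>
      rw [hne 0 j.succ_ne_zero.symm, mul_assoc,
        ih j hj (fun i hi => hne _ (Fin.succ_injective _ |>.ne hi)) fun i => hx _]

section Operators

variable {K R : Type*} {n : ℕ} [CommRing K] [CommRing R] [Algebra K R]
  (D : CoordinateDerivations K R n)

/-- The operator `∂^a = ∂_1^{a_1} ⋯ ∂_n^{a_n}`. -/
noncomputable def partialPow (a : Fin n →₀ ℕ) : Module.End K R :=
  (List.ofFn fun i => (D.der i : Module.End K R) ^ a i).prod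

/-- The operator `∑ f_a ∂^a` with normally ordered symbol `∑ f_a ξ^a`. -/
noncomputable def op : MvPolynomial (Fin n) R →ₗ[R] Module.End K R :=
  (basisMonomials (Fin n) R).constr R D.partialPow

theorem op_monomial (a : Fin n →₀ ℕ) (f : R) : D.op (monomial a f) = f • D.partialPow a := by
  have hbasis := (basisMonomials (Fin n) R).constr_basis R D.partialPow a
  rw [coe_basisMonomials] at hbasis
  rw [← hbasis, ← mul_one f, ← smul_eq_mul, ← smul_monomial, map_smul, smul_eq_mul, mul_one]
  rfl

theorem op_C_mul (f : R) (φ : MvPolynomial (Fin n) R) : D.op (C f * φ) = f • D.op φ := by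
  rw [C_mul', map_smul]

theorem partialPow_zero : D.partialPow 0 = 1 := by
  simp [partialPow, List.ofFn_const]

theorem op_C (f : R) : D.op (C f) = f • (1 : Module.End K R) := by
  rw [← partialPow_zero, ← op_monomial]
  rfl

theorem commute_der (i j : Fin n) :
    Commute (D.der i : Module.End K R) (D.der j : Module.End K R) :=
  LinearMap.ext fun f => D.der_comm i j f

theorem partialPow_add_single (a : Fin n →₀ ℕ) (j : Fin n) :
    D.partialPow (a + Finsupp.single j 1) = D.partialPow a * (D.der j : Module.End K R) := by
  refine list_prod_ofFn_eq_mul j ?_ (fun i hi => ?_) fun i => (D.commute_der j i).pow_right _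
  · rw [Finsupp.add_apply, Finsupp.single_eq_same, pow_succ]
  · rw [Finsupp.add_apply, Finsupp.single_eq_of_ne hi, add_zero]

theorem op_mul_X (φ : MvPolynomial (Fin n) R) (j : Fin n) :
    D.op (φ * X j) = D.op φ * (D.der j : Module.End K R) := by
  induction φ using MvPolynomial.induction_on' with
  | monomial a f =>
    rw [X, monomial_mul, mul_one, op_monomial, op_monomial, partialPow_add_single, smul_mul_assoc]
  | add φ ψ hφ hψ => rw [add_mul, map_add, map_add, add_mul, hφ, hψ]

theorem op_X (j : Fin n) : D.op (X j) = (D.der j : Module.End K R) := by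
  rw [← one_mul (X j), op_mul_X, ← C_1, op_C, one_smul, one_mul]

theorem der_mul_smul (k : Fin n) (f : R) (P : Module.End K R) :
    (D.der k : Module.End K R) * (f • P) = f • ((D.der k : Module.End K R) * P) + D.der k f • P :=
  LinearMap.ext fun g => (D.der k).leibniz f (P g) |>.trans <| by
    simp [mul_comm (P g)]

theorem der_mul_op (k : Fin n) (φ : MvPolynomial (Fin n) R) :
    (D.der k : Module.End K R) * D.op φ = D.op (φ * X k + D.symbolDer k φ) := by
  induction φ using MvPolynomial.induction_on with
  | C f => simp only [map_add, op_mul_X, op_C, symbolDer_C, der_mul_smul, smul_mul_assoc, one_mul,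
      mul_one]
  | add φ ψ hφ hψ =>
    rw [map_add, mul_add, hφ, hψ, map_add (D.symbolDer k), add_mul, ← map_add]
    congr 1
    ring
  | mul_X φ j h =>
    rw [op_mul_X, ← mul_assoc, h, ← op_mul_X, Derivation.leibniz, symbolDer_X, smul_zero, zero_add,
      smul_eq_mul]
    congr 1
    ring

theorem der_mul_mulLeft (i : Fin n) (f : R) :
    (D.der i : Module.End K R) * LinearMap.mulLeft K f =
      LinearMap.mulLeft K f * (D.der i : Module.End K R) + LinearMap.mulLeft K (D.der i f) :=
  LinearMap.ext fun g => ((D.der i).leibniz f g).trans <| by simp [mul_comm g]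

theorem op_mul_mulLeft_homCoord (φ : MvPolynomial (Fin n) R) (l : Fin (n + 1)) :
    D.op φ * LinearMap.mulLeft K (D.homCoord l) =
      D.op (C (D.homCoord l) * φ + homPderiv l φ) := by
  cases l using Fin.cases with
  | zero =>
    simp only [homCoord_zero, homPderiv_zero, map_one, one_mul, add_zero]
    exact LinearMap.ext fun g => congrArg (D.op φ) (one_mul g)
  | succ j =>
    simp only [homCoord_succ, homPderiv_succ]
    induction φ using MvPolynomial.induction_on with
    | C f =>
      rw [pderiv_C, add_zero, op_C_mul, op_C]
      exact LinearMap.ext fun g => mul_left_comm _ _ _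
    | add φ ψ hφ hψ => simp only [map_add, add_mul, mul_add, hφ, hψ]; abel
    | mul_X φ i h =>
      rw [op_mul_X, mul_assoc, der_mul_mulLeft, mul_add, ← mul_assoc, h, ← op_mul_X, der_coord,
        Derivation.leibniz, pderiv_X, Pi.single_apply, smul_eq_mul, smul_eq_mul]
      rcases eq_or_ne i j with rfl | hij
      · have hone : LinearMap.mulLeft K (1 : R) = 1 := LinearMap.mulLeft_one K R
        rw [if_pos rfl, if_pos rfl, hone, mul_one, ← map_add]
        congr 1
        ring
      · have hzero : LinearMap.mulLeft K (0 : R) = 0 := LinearMap.mulLeft_zero_eq_zero K R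
        rw [if_neg hij, if_neg hij, hzero, mul_zero, add_zero]
        congr 1
        ring

theorem op_homMomentum_zero_mul_op (φ : MvPolynomial (Fin n) R) :
    D.op (D.homMomentum 0) * D.op φ = D.op (D.homMomentum 0 * φ + D.homDer 0 φ - euler φ) := by
  have hterm (i : Fin n) : D.op (C (D.coord i) * X i) * D.op φ =
      D.op (C (D.coord i) * X i * φ + C (D.coord i) * D.symbolDer i φ) := by
    rw [op_C_mul, op_X, smul_mul_assoc, der_mul_op, ← op_C_mul]
    congr 1
    ring
  rw [homMomentum_zero, ← zero_sub, map_sub, sub_mul, map_zero, zero_mul, map_sum, Finset.sum_mul,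
    Finset.sum_congr rfl fun i _ => hterm i, ← map_sum, ← map_zero D.op, ← map_sub,
    homDer_zero_apply, Finset.sum_add_distrib, ← Finset.sum_mul]
  congr 1
  ring

theorem op_mul_op_homMomentum_zero (φ : MvPolynomial (Fin n) R) :
    D.op φ * D.op (D.homMomentum 0) = D.op (D.homMomentum 0 * φ - euler φ) := by
  have hterm (i : Fin n) : D.op φ * D.op (C (D.coord i) * X i) =
      D.op (C (D.coord i) * X i * φ + X i * pderiv i φ) := by
    have hmul : D.op (C (D.coord i) * X i) =
        LinearMap.mulLeft K (D.coord i) * (D.der i : Module.End K R) := by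
      rw [op_C_mul, op_X]
      rfl
    rw [hmul, ← mul_assoc, ← homCoord_succ, op_mul_mulLeft_homCoord, ← op_mul_X, homPderiv_succ]
    congr 1
    ring
  rw [homMomentum_zero, ← zero_sub, map_sub, mul_sub, map_zero, mul_zero, map_sum, Finset.mul_sum,
    Finset.sum_congr rfl fun i _ => hterm i, ← map_sum, ← map_zero D.op, ← map_sub, euler_apply,
    Finset.sum_add_distrib, ← Finset.sum_mul]
  congr 1
  ring

theorem op_mul_op_homMomentum (k : Fin (n + 1)) (φ : MvPolynomial (Fin n) R) :
    D.op φ * D.op (D.homMomentum k) =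
      D.op (D.homMomentum k * φ - if k = 0 then euler φ else 0) := by
  cases k using Fin.cases with
  | zero => rw [if_pos rfl, op_mul_op_homMomentum_zero]
  | succ i => rw [if_neg i.succ_ne_zero, sub_zero, homMomentum_succ, op_X, ← op_mul_X, mul_comm]

theorem op_homMomentum_commutator (k : Fin (n + 1)) (φ : MvPolynomial (Fin n) R) :
    D.op (D.homMomentum k) * D.op φ - D.op φ * D.op (D.homMomentum k) = D.op (D.homDer k φ) := by
  cases k using Fin.cases with
  | zero =>
    rw [op_homMomentum_zero_mul_op, op_mul_op_homMomentum_zero, ← map_sub]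
    congr 1
    ring
  | succ i =>
    rw [homMomentum_succ, op_X, der_mul_op, ← op_mul_X, ← map_sub, add_sub_cancel_left, homDer_succ]

/-! ### Projective vector fields -/

/-- The components of the vector field whose principal symbol is `homMomentum k`. -/
def homField : Fin (n + 1) → Fin n → R :=
  Fin.cons (-D.coord) fun i => Pi.single i 1

/-- The vector field on affine space generated by the matrix unit `E_{kj}`. -/
def fieldUnit (k j : Fin (n + 1)) (i : Fin n) : R :=
  D.homCoord j * D.homField k i

/-- The principal symbol `∑ η_i ξ_i` of the vector field `η = ∑ η_i ∂_i`. -/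
noncomputable def momentum : (Fin n → R) →ₗ[R] MvPolynomial (Fin n) R :=
  Fintype.linearCombination R X

theorem momentum_apply (η : Fin n → R) : momentum η = ∑ i, C (η i) * X i := by
  simp only [momentum, Fintype.linearCombination_apply, C_mul']

/-- The Poisson bracket of symbols. -/
noncomputable def poisson :
    MvPolynomial (Fin n) R →ₗ[K] MvPolynomial (Fin n) R →ₗ[K] MvPolynomial (Fin n) R :=
  ∑ i, ((LinearMap.mul K (MvPolynomial (Fin n) R)).compl₁₂
      ((pderiv i).restrictScalars K : Derivation K _ (MvPolynomial (Fin n) R)).toLinearMap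
      (D.symbolDer i).toLinearMap -
    (LinearMap.mul K (MvPolynomial (Fin n) R)).compl₁₂ (D.symbolDer i).toLinearMap
      ((pderiv i).restrictScalars K : Derivation K _ (MvPolynomial (Fin n) R)).toLinearMap)

theorem poisson_apply (φ ψ : MvPolynomial (Fin n) R) : D.poisson φ ψ =
    ∑ i, (pderiv i φ * D.symbolDer i ψ - D.symbolDer i φ * pderiv i ψ) := by
  simp only [poisson, LinearMap.sum_apply, LinearMap.sub_apply]
  rfl

theorem poisson_mul (φ φ' ψ : MvPolynomial (Fin n) R) :
    D.poisson (φ * φ') ψ = φ * D.poisson φ' ψ + φ' * D.poisson φ ψ := by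
  simp only [poisson_apply, Finset.mul_sum, ← Finset.sum_add_distrib, Derivation.leibniz,
    smul_eq_mul]
  exact Finset.sum_congr rfl fun i _ => by ring

theorem poisson_homCoord (j : Fin (n + 1)) (φ : MvPolynomial (Fin n) R) :
    D.poisson (C (D.homCoord j)) φ = -homPderiv j φ := by
  simp only [poisson_apply, pderiv_C, zero_mul, zero_sub, Finset.sum_neg_distrib,
    sum_symbolDer_homCoord_mul_pderiv]

theorem poisson_X (i : Fin n) (φ : MvPolynomial (Fin n) R) :
    D.poisson (X i) φ = D.symbolDer i φ := by
  classical
  simp [poisson_apply, pderiv_X, symbolDer_X, Pi.single_apply]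

theorem poisson_homMomentum (k : Fin (n + 1)) (φ : MvPolynomial (Fin n) R) :
    D.poisson (D.homMomentum k) φ = D.homDer k φ := by
  cases k using Fin.cases with
  | zero =>
    simp only [homMomentum_zero, map_neg, map_sum, LinearMap.neg_apply, LinearMap.sum_apply,
      poisson_mul, poisson_X, ← homCoord_succ, poisson_homCoord, homDer_zero_apply, euler_apply,
      homPderiv_succ, Finset.sum_add_distrib, mul_neg, Finset.sum_neg_distrib]
    ring
  | succ i => exact D.poisson_X i φ

theorem momentum_homField (k : Fin (n + 1)) : momentum (D.homField k) = D.homMomentum k := by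
  classical
  cases k using Fin.cases with
  | zero => simp [momentum_apply, homField, homMomentum_zero]
  | succ i => simp [momentum_apply, homField, homMomentum_succ, Pi.single_apply]

theorem poisson_momentum_fieldUnit (k j : Fin (n + 1)) (φ : MvPolynomial (Fin n) R) :
    D.poisson (momentum (D.fieldUnit k j)) φ = D.glAction k j φ := by
  have hsmul : D.fieldUnit k j = D.homCoord j • D.homField k := rfl
  rw [hsmul, map_smul, momentum_homField, ← C_mul', poisson_mul, poisson_homMomentum,
    poisson_homCoord, glAction_apply, mul_neg, sub_eq_add_neg]

/-- The Lie derivative on `l`-densities along a vector field. -/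
noncomputable def lieDensity (l : K) : (Fin n → R) →ₗ[K] Module.End K R where
  toFun η := ∑ i, LinearMap.mulLeft K (η i) * (D.der i : Module.End K R)
    + l • LinearMap.mulLeft K (∑ i, D.der i (η i))
  map_add' η θ := LinearMap.ext fun f => by
    simp only [Pi.add_apply, map_add, Finset.sum_add_distrib, LinearMap.add_apply,
      LinearMap.coe_sum, Finset.sum_apply, Module.End.mul_apply, Derivation.coeFn_coe,
      LinearMap.mulLeft_apply, add_mul, LinearMap.smul_apply, smul_add]
    ring
  map_smul' c η := LinearMap.ext fun f => by
    simp [← Finset.smul_sum, smul_comm c l]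

theorem lieDensity_apply (l : K) (η : Fin n → R) : D.lieDensity l η =
    D.op (momentum η) + l • LinearMap.mulLeft K (∑ i, D.der i (η i)) := by
  rw [momentum_apply, map_sum]
  simp only [op_C_mul, op_X]
  rfl

theorem sum_coord_mul_der_homCoord (j : Fin (n + 1)) :
    ∑ i, D.coord i * D.der i (D.homCoord j) = D.homCoord j - if j = 0 then 1 else 0 := by
  cases j using Fin.cases with
  | zero => simp [homCoord_zero]
  | succ j => simp [homCoord_succ, der_coord]

theorem sum_der_fieldUnit_zero (j : Fin (n + 1)) : ∑ i, D.der i (D.fieldUnit 0 j i) =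
    (if j = 0 then 1 else 0) - (n + 1) * D.homCoord j := by
  have hterm (i : Fin n) : D.der i (D.fieldUnit 0 j i) =
      -(D.homCoord j + D.coord i * D.der i (D.homCoord j)) := by
    simp [fieldUnit, homField, der_coord]
  simp only [hterm, Finset.sum_neg_distrib, Finset.sum_add_distrib, sum_coord_mul_der_homCoord,
    Finset.sum_const, Finset.card_univ, Fintype.card_fin, nsmul_eq_mul]
  ring

theorem sum_der_fieldUnit_succ (i : Fin n) (j : Fin (n + 1)) :
    ∑ r, D.der r (D.fieldUnit i.succ j r) = if i.succ = j then 1 else 0 := by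
  classical
  cases j using Fin.cases with
  | zero => simp [fieldUnit, homField, homCoord_zero, Pi.single_apply, apply_ite (D.der _)]
  | succ j =>
    simp [fieldUnit, homField, homCoord_succ, der_coord, Pi.single_apply, apply_ite (D.der _)]

theorem sum_der_fieldUnit (k j : Fin (n + 1)) : ∑ i, D.der i (D.fieldUnit k j i) =
    (if k = j then 1 else 0) - if k = 0 then (n + 1) * D.homCoord j else 0 := by
  cases k using Fin.cases with
  | zero => simp only [sum_der_fieldUnit_zero, if_true, eq_comm (a := j)]
  | succ i => rw [sum_der_fieldUnit_succ, if_neg i.succ_ne_zero, sub_zero]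

theorem lieDensity_fieldUnit (l : K) (k j : Fin (n + 1)) : D.lieDensity l (D.fieldUnit k j) =
    LinearMap.mulLeft K (D.homCoord j) *
        (D.op (D.homMomentum k) - (if k = 0 then l * (n + 1) else 0) • 1) +
      (if k = j then l else 0) • 1 := by
  have hsmul : D.fieldUnit k j = D.homCoord j • D.homField k := rfl
  rw [lieDensity_apply, sum_der_fieldUnit, hsmul, map_smul, momentum_homField, map_smul]
  refine LinearMap.ext fun f => ?_
  simp only [Algebra.smul_def, LinearMap.add_apply, LinearMap.smul_apply, Module.End.mul_apply,
    LinearMap.mulLeft_apply, Module.algebraMap_end_apply, mul_one, LinearMap.sub_apply,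
    apply_ite (algebraMap K R), map_mul, map_add, map_natCast, map_one, map_zero, ite_mul, zero_mul,
    Algebra.algebraMap_self, RingHom.id_apply]
  split_ifs <;> ring

theorem commutator_mul_sub_add {A : Type*} [Ring A] [Algebra K A] {m P H : A}
    (h : P * m = m * P + H) (X : A) (b c : K) :
    (m * (X - b • 1) + c • 1) * P - P * (m * (X - b • 1) + c • 1) =
      m * (X * P - P * X) - H * X + b • H := by
  have hPm : P * (m * (X - b • 1)) = (m * P + H) * (X - b • 1) := by rw [← mul_assoc, h]
  rw [mul_add, hPm]
  simp only [mul_sub, sub_mul, add_mul, mul_smul_comm, smul_mul_assoc, mul_one, one_mul, mul_assoc,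
    smul_add]
  abel

theorem lieDensity_fieldUnit_commutator (l : K) (k j : Fin (n + 1)) (φ : MvPolynomial (Fin n) R) :
    D.lieDensity l (D.fieldUnit k j) * D.op φ - D.op φ * D.lieDensity l (D.fieldUnit k j) =
      D.op (D.densityAction l k j φ) := by
  have hcoord : D.op φ * LinearMap.mulLeft K (D.homCoord j) =
      LinearMap.mulLeft K (D.homCoord j) * D.op φ + D.op (homPderiv j φ) := by
    rw [op_mul_mulLeft_homCoord, map_add, op_C_mul]
    rfl
  have hdensity : D.densityAction l k j φ = C (D.homCoord j) * D.homDer k φ -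
      (D.homMomentum k * homPderiv j φ - if k = 0 then euler (homPderiv j φ) else 0) +
      (if k = 0 then l * (n + 1) else 0) • homPderiv j φ := by
    cases k using Fin.cases with
    | zero =>
      rw [densityAction_zero_apply, glAction_apply, if_pos rfl, if_pos rfl]
      ring
    | succ i =>
      rw [densityAction_succ_apply, glAction_apply, if_neg i.succ_ne_zero, if_neg i.succ_ne_zero,
        sub_zero, zero_smul, add_zero]
  have hcommutator := commutator_mul_sub_add hcoord (D.op (D.homMomentum k))
    (if k = 0 then l * (n + 1) else 0) (if k = j then l else 0)
  rw [lieDensity_fieldUnit, hcommutator, op_homMomentum_commutator, op_mul_op_homMomentum, hdensity,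
    map_add, map_sub D.op (C _ * _), op_C_mul, LinearMap.map_smul_of_tower]
  rfl

/-- The vector field on affine space generated by a matrix. -/
def projField : Matrix (Fin (n + 1)) (Fin (n + 1)) K →ₗ[K] Fin n → R where
  toFun x i := ∑ l, x i.succ l • D.homCoord l - D.coord i * ∑ l, x 0 l • D.homCoord l
  map_add' x y := funext fun i => by
    simp only [Matrix.add_apply, add_smul, Finset.sum_add_distrib, Pi.add_apply]
    ring
  map_smul' c x := funext fun i => by
    simp only [Matrix.smul_apply, smul_assoc, ← Finset.smul_sum, Pi.smul_apply, mul_smul_comm,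
      smul_sub, RingHom.id_apply]

theorem projField_eq_sum (x : Matrix (Fin (n + 1)) (Fin (n + 1)) K) :
    D.projField x = ∑ k, ∑ j, x k j • D.fieldUnit k j := by
  classical
  funext i
  have hsucc : ∑ r : Fin n, ∑ j, x r.succ j • D.fieldUnit r.succ j i =
      ∑ j, x i.succ j • D.homCoord j := by
    rw [Finset.sum_eq_single_of_mem i (Finset.mem_univ i) fun r _ hr => ?_]
    · simp [fieldUnit, homField]
    · simp [fieldUnit, homField, hr.symm]
  have hzero : ∑ j, x 0 j • D.fieldUnit 0 j i = -(D.coord i * ∑ j, x 0 j • D.homCoord j) := by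
    simp only [fieldUnit, homField, Fin.cons_zero, Pi.neg_apply, mul_neg, smul_neg,
      Finset.sum_neg_distrib, mul_comm (D.coord i), Finset.sum_mul, smul_mul_assoc]
  rw [Finset.sum_apply, Fin.sum_univ_succ]
  simp only [Finset.sum_apply, Pi.smul_apply]
  rw [hsucc, hzero, neg_add_eq_sub]
  rfl

theorem projField_single (k j : Fin (n + 1)) :
    D.projField (Matrix.single k j 1) = D.fieldUnit k j := by
  classical
  rw [projField_eq_sum, Finset.sum_eq_single_of_mem k (Finset.mem_univ k) fun r _ hr => ?_,
    Finset.sum_eq_single_of_mem j (Finset.mem_univ j) fun r _ hr => ?_]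
  · rw [Matrix.single_apply_same, one_smul]
  · rw [Matrix.single_apply_of_col_ne _ _ hr.symm, zero_smul]
  · exact Finset.sum_eq_zero fun s _ => by rw [Matrix.single_apply_of_row_ne hr.symm, zero_smul]

theorem projField_one : D.projField 1 = 0 := by
  funext i
  simp [projField, Matrix.one_apply, homCoord_zero, homCoord_succ]

end Operators
/-! ### The quantization map -/

section Quantization

theorem exists_trace_eq_zero_projField_eq {F K R : Type*} {n : ℕ} [Field F] [CharZero F]
    [CommRing K] [Algebra F K] [CommRing R] [Algebra K R] (D : CoordinateDerivations K R n)
    (k j : Fin (n + 1)) : ∃ x : Matrix (Fin (n + 1)) (Fin (n + 1)) F, x.trace = 0 ∧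
      D.projField (x.map (algebraMap F K)) = D.fieldUnit k j := by
  set e : Matrix (Fin (n + 1)) (Fin (n + 1)) F := Matrix.single k j 1
  refine ⟨e - (e.trace / (n + 1)) • 1, ?_, ?_⟩
  · have hn : (n + 1 : F) ≠ 0 := Nat.cast_add_one_ne_zero n
    rw [Matrix.trace_sub, Matrix.trace_smul, Matrix.trace_one, Fintype.card_fin, Nat.cast_succ,
      smul_eq_mul, div_mul_cancel₀ _ hn, sub_self]
  · have hmap : (e - (e.trace / (n + 1)) • 1).map (algebraMap F K) =
        Matrix.single k j 1 - algebraMap F K (e.trace / (n + 1)) • 1 := by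
      rw [Matrix.map_sub _ (map_sub _), Matrix.map_smul' _ _ _ (map_mul _), Matrix.map_single,
        map_one, Matrix.map_one _ (map_zero _) (map_one _)]
    rw [hmap, map_sub, map_smul, projField_one, smul_zero, sub_zero, projField_single]

section

variable {K R : Type*} {n : ℕ} [CommRing K] [CommRing R] [Algebra K R]
  (D : CoordinateDerivations K R n)

theorem op_injective [IsAddTorsionFree R] : Function.Injective D.op := by
  rw [injective_iff_map_eq_zero]
  intro φ hφ
  suffices ∀ m φ, φ ∈ degreeLT (Fin n) R m → D.op φ = 0 → φ = 0 from
    this _ φ (mem_degreeLT_totalDegree_add_one φ) hφ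
  intro m
  induction m with
  | zero => exact fun φ hm _ => eq_zero_of_mem_degreeLT_zero hm
  | succ m ih =>
    intro φ hm hφ
    have hpderiv (i : Fin n) : pderiv i φ = 0 := ih _ (pderiv_mem_degreeLT hm i) <| by
      have hcommutator := D.op_mul_mulLeft_homCoord φ i.succ
      rwa [map_add, op_C_mul, hφ, zero_mul, smul_zero, zero_add, homPderiv_succ, eq_comm]
        at hcommutator
    have hzero : φ.IsHomogeneous 0 := isHomogeneous_of_euler <| by
      simp only [euler_apply, hpderiv, mul_zero, Finset.sum_const_zero, zero_smul]
    obtain ⟨f, rfl⟩ : ∃ f, φ = C f :=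
      ⟨_, totalDegree_eq_zero_iff_eq_C.1 ((totalDegree_zero_iff_isHomogeneous _).2 hzero)⟩
    have hone := LinearMap.congr_fun hφ 1
    rw [op_C, LinearMap.smul_apply, Module.End.one_apply, smul_eq_mul, mul_one,
      LinearMap.zero_apply] at hone
    rw [hone, map_zero]

theorem apply_poisson_momentum_projField {l : K}
    {Q : MvPolynomial (Fin n) R →ₗ[K] Module.End K R}
    (hQ : ∀ k j φ, Q (D.glAction k j φ) =
      D.lieDensity l (D.fieldUnit k j) * Q φ - Q φ * D.lieDensity l (D.fieldUnit k j))
    (x : Matrix (Fin (n + 1)) (Fin (n + 1)) K) (φ : MvPolynomial (Fin n) R) :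
    Q (D.poisson (momentum (D.projField x)) φ) =
      D.lieDensity l (D.projField x) * Q φ - Q φ * D.lieDensity l (D.projField x) := by
  simp only [projField_eq_sum, map_sum, LinearMap.map_smul_of_tower, map_smul,
    LinearMap.sum_apply, LinearMap.smul_apply, poisson_momentum_fieldUnit, hQ, Finset.sum_mul,
    Finset.mul_sum, smul_mul_assoc, mul_smul_comm, smul_sub, Finset.sum_sub_distrib]

end

variable {K R : Type*} {n : ℕ} [Field K] [CommRing R] [Algebra K R]
  (D : CoordinateDerivations K R n)

/-- The projectively equivariant quantization map for operators on `l`-densities. -/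
noncomputable def quantization (l : K) : MvPolynomial (Fin n) R →ₗ[K] Module.End K R :=
  D.op.restrictScalars K ∘ₗ
    (LinearEquiv.ofBijective (D.symbolMap l) (D.isUnipotent_symbolMap l).bijective).symm

theorem quantization_symbolMap (l : K) (ψ : MvPolynomial (Fin n) R) :
    D.quantization l (D.symbolMap l ψ) = D.op ψ :=
  congrArg D.op (LinearEquiv.ofBijective_symm_apply_apply _ ψ)

theorem exists_quantization_eq_op_add (l : K) {d : ℕ} {φ : MvPolynomial (Fin n) R}
    (h : φ.IsHomogeneous d) :
    ∃ χ ∈ degreeLT (Fin n) R d, D.quantization l φ = D.op (φ + χ) := by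
  have hunipotent := D.isUnipotent_symbolMap l
  obtain ⟨ψ, hψ, rfl⟩ :=
    hunipotent.exists_mem_degreeLT_apply_eq (mem_degreeLT_of_isHomogeneous h)
  refine ⟨ψ - D.symbolMap l ψ, sub_mem_comm_iff.1 (hunipotent.sub_mem_degreeLT hψ), ?_⟩
  rw [quantization_symbolMap, add_sub_cancel]

variable [CharZero K]

theorem quantization_injective (l : K) : Function.Injective (D.quantization l) :=
  have := IsAddTorsionFree.of_isTorsionFree K R
  D.op_injective.comp (LinearEquiv.injective _)

theorem quantization_glAction (l : K) (k j : Fin (n + 1)) (φ : MvPolynomial (Fin n) R) :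
    D.quantization l (D.glAction k j φ) =
      D.lieDensity l (D.fieldUnit k j) * D.quantization l φ -
        D.quantization l φ * D.lieDensity l (D.fieldUnit k j) := by
  obtain ⟨ψ, rfl⟩ := (D.isUnipotent_symbolMap l).bijective.surjective φ
  rw [← symbolMap_densityAction, quantization_symbolMap, quantization_symbolMap,
    lieDensity_fieldUnit_commutator]

theorem eq_quantization {l : K} {Q : MvPolynomial (Fin n) R →ₗ[K] Module.End K R}
    (hsymbol : ∀ d φ, φ.IsHomogeneous d → ∃ χ ∈ degreeLT (Fin n) R d, Q φ = D.op (φ + χ))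
    (hQ : ∀ k j φ, Q (D.glAction k j φ) =
      D.lieDensity l (D.fieldUnit k j) * Q φ - Q φ * D.lieDensity l (D.fieldUnit k j)) :
    Q = D.quantization l := by
  have := IsAddTorsionFree.of_isTorsionFree K R
  have hrange (φ : MvPolynomial (Fin n) R) : Q φ ∈ LinearMap.range (D.op.restrictScalars K) := by
    rw [← sum_homogeneousComponent φ, map_sum]
    refine Submodule.sum_mem _ fun d _ => ?_
    obtain ⟨χ, -, hχ⟩ := hsymbol d _ (homogeneousComponent_isHomogeneous d φ)
    exact ⟨_, hχ.symm⟩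
  obtain ⟨T, hT⟩ := (D.op.restrictScalars K).exists_leftInverse_of_injective
    (LinearMap.ker_eq_bot.2 D.op_injective)
  set S : Module.End K (MvPolynomial (Fin n) R) := T ∘ₗ Q
  have hS (φ : MvPolynomial (Fin n) R) : D.op (S φ) = Q φ := by
    obtain ⟨ψ, hψ⟩ := hrange φ
    rw [LinearMap.comp_apply, ← hψ]
    exact congrArg D.op (LinearMap.congr_fun hT ψ)
  have hunipotent : IsUnipotent S := fun d φ hφ => by
    obtain ⟨χ, hχ, hop⟩ := hsymbol d φ hφ
    rwa [D.op_injective ((hS φ).trans hop), add_sub_cancel_left]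
  have hone : D.symbolMap l * S = 1 :=
    D.eq_one_of_commute_glAction ((D.isUnipotent_symbolMap l).mul hunipotent) fun k j φ => by
      rw [Module.End.mul_apply, Module.End.mul_apply, ← symbolMap_densityAction]
      congr 1
      apply D.op_injective
      rw [hS, hQ, ← hS, lieDensity_fieldUnit_commutator]
  refine LinearMap.ext fun φ => ?_
  rw [← hS, ← D.quantization_symbolMap l, ← Module.End.mul_apply, hone, Module.End.one_apply]

end Quantization

/-! ### Composition of operators -/

section Composition

variable {K R : Type*} {n : ℕ} [CommRing K] [CommRing R] [Algebra K R]
  (D : CoordinateDerivations K R n)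

/-- Left composition with the operator `op φ` of order at most `a` is known up to terms of order
two below the leading one. -/
def HasFirstOrderComp (a : ℕ) (φ : MvPolynomial (Fin n) R) : Prop :=
  ∀ b, ∀ ψ ∈ degreeLT (Fin n) R (b + 1), ∃ r ∈ degreeLT (Fin n) R (a + b - 1),
    D.op φ * D.op ψ = D.op (φ * ψ + ∑ i, pderiv i φ * D.symbolDer i ψ + r)

variable {D}

theorem HasFirstOrderComp.mono {a a' : ℕ} (h : a ≤ a') {φ : MvPolynomial (Fin n) R}
    (hφ : D.HasFirstOrderComp a φ) : D.HasFirstOrderComp a' φ := fun b ψ hψ =>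
  let ⟨r, hr, hcomp⟩ := hφ b ψ hψ
  ⟨r, degreeLT_mono (by omega) hr, hcomp⟩

theorem HasFirstOrderComp.add {a : ℕ} {φ φ' : MvPolynomial (Fin n) R}
    (hφ : D.HasFirstOrderComp a φ) (hφ' : D.HasFirstOrderComp a φ') :
    D.HasFirstOrderComp a (φ + φ') := fun b ψ hψ => by
  obtain ⟨r, hr, hcomp⟩ := hφ b ψ hψ
  obtain ⟨r', hr', hcomp'⟩ := hφ' b ψ hψ
  refine ⟨r + r', Submodule.add_mem _ hr hr', ?_⟩
  rw [map_add, add_mul, hcomp, hcomp', ← map_add]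
  congr 1
  simp only [map_add, add_mul, Finset.sum_add_distrib]
  ring

theorem hasFirstOrderComp_C (f : R) : D.HasFirstOrderComp 0 (C f) := fun b ψ _ =>
  ⟨0, Submodule.zero_mem _, by
    simp only [pderiv_C, zero_mul, Finset.sum_const_zero, add_zero, op_C_mul, op_C,
      smul_mul_assoc, one_mul]⟩

theorem sum_pderiv_mul_symbolDer_mul_X (φ ψ : MvPolynomial (Fin n) R) (j : Fin n) :
    ∑ i, pderiv i φ * D.symbolDer i (ψ * X j) = X j * ∑ i, pderiv i φ * D.symbolDer i ψ := by
  rw [Finset.mul_sum]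
  refine Finset.sum_congr rfl fun i _ => ?_
  rw [Derivation.leibniz, symbolDer_X, smul_zero, zero_add, smul_eq_mul, mul_left_comm]

theorem sum_pderiv_mul_X_mul_symbolDer (φ ψ : MvPolynomial (Fin n) R) (j : Fin n) :
    ∑ i, pderiv i (φ * X j) * D.symbolDer i ψ =
      φ * D.symbolDer j ψ + X j * ∑ i, pderiv i φ * D.symbolDer i ψ := by
  classical
  simp only [Derivation.leibniz, pderiv_X, Pi.single_apply, smul_eq_mul, add_mul, mul_assoc,
    Finset.sum_add_distrib, Finset.mul_sum, ite_mul, one_mul, zero_mul, mul_ite, mul_zero,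
    Finset.sum_ite_eq, Finset.mem_univ, if_true]

theorem HasFirstOrderComp.mul_X {a : ℕ} {φ : MvPolynomial (Fin n) R}
    (hφ : D.HasFirstOrderComp a φ) (hmem : φ ∈ degreeLT (Fin n) R (a + 1)) (j : Fin n) :
    D.HasFirstOrderComp (a + 1) (φ * X j) := fun b ψ hψ => by
  have hX : X j ∈ degreeLT (Fin n) R 2 := mem_degreeLT_of_isHomogeneous (isHomogeneous_X R j)
  obtain ⟨r, hr, hcomp⟩ := hφ (b + 1) (ψ * X j) (degreeLT_mono (by omega) (mul_mem_degreeLT hψ hX))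
  obtain ⟨r', hr', hcomp'⟩ := hφ b (D.symbolDer j ψ) (D.symbolDer_mem_degreeLT hψ j)
  refine ⟨r + r' + ∑ i, pderiv i φ * D.symbolDer i (D.symbolDer j ψ), ?_, ?_⟩
  · refine Submodule.add_mem _ (Submodule.add_mem _ (degreeLT_mono (by omega) hr)
      (degreeLT_mono (by omega) hr')) (Submodule.sum_mem _ fun i _ => ?_)
    exact degreeLT_mono (by omega) (mul_mem_degreeLT (pderiv_mem_degreeLT hmem i)
      (D.symbolDer_mem_degreeLT (D.symbolDer_mem_degreeLT hψ j) i))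
  · rw [op_mul_X, mul_assoc, der_mul_op, map_add D.op (ψ * X j), mul_add, hcomp, hcomp', ← map_add,
      sum_pderiv_mul_symbolDer_mul_X, sum_pderiv_mul_X_mul_symbolDer]
    congr 1
    ring

theorem hasFirstOrderComp_of_mem_degreeLT {a : ℕ} {φ : MvPolynomial (Fin n) R}
    (h : φ ∈ degreeLT (Fin n) R (a + 1)) : D.HasFirstOrderComp a φ := by
  have hzero (a : ℕ) : D.HasFirstOrderComp a 0 := by
    have hC : D.HasFirstOrderComp 0 (C 0) := hasFirstOrderComp_C 0
    rw [C_0] at hC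
    exact hC.mono a.zero_le
  have hmonomial (c : Fin n →₀ ℕ) (f : R) :
      ∀ a, monomial c f ∈ degreeLT (Fin n) R (a + 1) → D.HasFirstOrderComp a (monomial c f) := by
    refine induction_on_monomial
      (motive := fun φ => ∀ a, φ ∈ degreeLT (Fin n) R (a + 1) → D.HasFirstOrderComp a φ)
      (fun f a _ => (hasFirstOrderComp_C f).mono a.zero_le) (fun φ j ih a ha => ?_) c f
    have hφ := mem_degreeLT_of_mul_X_mem ha
    cases a with
    | zero => rw [eq_zero_of_mem_degreeLT_zero hφ, zero_mul]; exact hzero 0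
    | succ a => exact (ih a hφ).mul_X hφ j
  rw [φ.as_sum]
  refine Finset.sum_induction _ _ (fun _ _ => HasFirstOrderComp.add) (hzero a) fun c hc => ?_
  exact hmonomial c _ a <| degreeLT_mono (mem_degreeLT_iff_support.1 h c hc)
    (mem_degreeLT_of_isHomogeneous (isHomogeneous_monomial _ rfl))

theorem mul_add_sum_mem_degreeLT {a b : ℕ} {φ ψ r : MvPolynomial (Fin n) R}
    (hφ : φ ∈ degreeLT (Fin n) R (a + 1)) (hψ : ψ ∈ degreeLT (Fin n) R (b + 1))
    (hr : r ∈ degreeLT (Fin n) R (a + b - 1)) :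
    φ * ψ + ∑ i, pderiv i φ * D.symbolDer i ψ + r ∈ degreeLT (Fin n) R (a + b + 1) := by
  refine Submodule.add_mem _ (Submodule.add_mem _
    (degreeLT_mono (by omega) (mul_mem_degreeLT hφ hψ)) (Submodule.sum_mem _ fun i _ => ?_))
    (degreeLT_mono (by omega) hr)
  exact degreeLT_mono (by omega)
    (mul_mem_degreeLT (pderiv_mem_degreeLT hφ i) (D.symbolDer_mem_degreeLT hψ i))

end Composition

/-! ### Half-densities -/

section HalfDensity

section

variable {K R : Type*} {n : ℕ} [CommRing K] [CommRing R] [Algebra K R]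
  (D : CoordinateDerivations K R n)

theorem symbolDer_isHomogeneous {d : ℕ} {φ : MvPolynomial (Fin n) R} (h : φ.IsHomogeneous d)
    (i : Fin n) : (D.symbolDer i φ).IsHomogeneous d := fun a ha =>
  h fun h0 => ha (by rw [coeff_symbolDer, h0, map_zero])

theorem poisson_isHomogeneous {a b : ℕ} {φ ψ : MvPolynomial (Fin n) R} (hφ : φ.IsHomogeneous a)
    (hψ : ψ.IsHomogeneous b) : (D.poisson φ ψ).IsHomogeneous (a + b - 1) := by
  rw [poisson_apply]
  refine IsHomogeneous.sum _ _ _ fun i _ => IsHomogeneous.sub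
    (pderiv_mul_isHomogeneous hφ (D.symbolDer_isHomogeneous hψ i) i) ?_
  rw [mul_comm, add_comm a]
  exact pderiv_mul_isHomogeneous hψ (D.symbolDer_isHomogeneous hφ i) i

theorem poisson_mem_degreeLT {m k : ℕ} {φ ψ : MvPolynomial (Fin n) R}
    (hφ : φ ∈ degreeLT (Fin n) R m) (hψ : ψ ∈ degreeLT (Fin n) R k) :
    D.poisson φ ψ ∈ degreeLT (Fin n) R (m + k - 2) := by
  rw [poisson_apply]
  refine Submodule.sum_mem _ fun i _ => Submodule.sub_mem _
    (mul_mem_degreeLT_of_mem_degreeLT_sub_one (pderiv_mem_degreeLT hφ i)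
      (D.symbolDer_mem_degreeLT hψ i)) ?_
  rw [mul_comm, add_comm m]
  exact mul_mem_degreeLT_of_mem_degreeLT_sub_one (pderiv_mem_degreeLT hψ i)
    (D.symbolDer_mem_degreeLT hφ i)

theorem poisson_of_isHomogeneous_zero {φ ψ : MvPolynomial (Fin n) R} (hφ : φ.IsHomogeneous 0)
    (hψ : ψ.IsHomogeneous 0) : D.poisson φ ψ = 0 :=
  eq_zero_of_mem_degreeLT_zero <| degreeLT_mono (by omega) <|
    D.poisson_mem_degreeLT (mem_degreeLT_of_isHomogeneous hφ) (mem_degreeLT_of_isHomogeneous hψ)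

theorem divergence_mul_eq_sub_poisson (φ ψ : MvPolynomial (Fin n) R) :
    D.divergence (φ * ψ) = φ * D.divergence ψ + ψ * D.divergence φ +
      2 • ∑ i, pderiv i φ * D.symbolDer i ψ - D.poisson φ ψ := by
  rw [divergence_mul, poisson_apply, Finset.sum_add_distrib, Finset.sum_sub_distrib, two_nsmul]
  ring

end

variable {K R : Type*} {n : ℕ} [Field K] [CommRing R] [Algebra K R]
  (D : CoordinateDerivations K R n)

theorem symbolMap_poisson_sub_mem_degreeLT (l : K) {a b : ℕ} {φ ψ : MvPolynomial (Fin n) R}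
    (hφ : φ ∈ degreeLT (Fin n) R (a + 1)) (hψ : ψ ∈ degreeLT (Fin n) R (b + 1)) :
    D.poisson (D.symbolMap l φ) (D.symbolMap l ψ) - D.poisson φ ψ ∈
      degreeLT (Fin n) R (a + b - 1) := by
  have hS := D.isUnipotent_symbolMap l
  have hleft := D.poisson_mem_degreeLT (hS.sub_mem_degreeLT hφ) (hS.apply_mem_degreeLT hψ)
  have hright := D.poisson_mem_degreeLT hφ (hS.sub_mem_degreeLT hψ)
  have hsum := Submodule.add_mem _ (degreeLT_mono (by omega : _ ≤ a + b - 1) hleft)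
    (degreeLT_mono (by omega : _ ≤ a + b - 1) hright)
  rwa [map_sub, map_sub, LinearMap.sub_apply, sub_add_sub_cancel] at hsum

variable [CharZero K]

theorem symbolCoeff_half_one {d : ℕ} (hd : d ≠ 0) :
    symbolCoeff n (1 / 2 : K) 1 d = -(1 / 2) := by
  have hden : 2 * (d : K) - 1 + n = ((d - 1 + d + n : ℕ) : K) := by
    push_cast [Nat.cast_sub (Nat.one_le_iff_ne_zero.2 hd)]
    ring
  have hne : 2 * (d : K) - 1 + n ≠ 0 := hden ▸ Nat.cast_ne_zero.2 (by omega)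
  simp only [symbolCoeff, Finset.prod_range_one, Nat.factorial_one, Nat.cast_one, Nat.cast_zero,
    sub_zero, pow_one]
  rw [show (d : K) - 1 + 1 / 2 * (n + 1) = 1 / 2 * (2 * d - 1 + n) by ring, mul_div_assoc,
    div_self hne]
  ring

theorem symbolMap_half_sub_mem_degreeLT_of_isHomogeneous {d : ℕ} {φ : MvPolynomial (Fin n) R}
    (h : φ.IsHomogeneous d) : D.symbolMap (1 / 2 : K) φ - (φ - (1 / 2 : K) • D.divergence φ) ∈
      degreeLT (Fin n) R (d - 1) := by
  have hmem := mem_degreeLT_of_isHomogeneous h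
  cases d with
  | zero =>
    rw [D.symbolMap_of_isHomogeneous_zero _ h,
      eq_zero_of_mem_degreeLT_zero (D.divergence_mem_degreeLT hmem), smul_zero, sub_zero, sub_self]
    exact Submodule.zero_mem _
  | succ d =>
    rw [D.symbolMap_of_isHomogeneous _ h, Finset.sum_range_succ', Finset.sum_range_succ',
      symbolCoeff_zero, zero_add, symbolCoeff_half_one d.succ_ne_zero, pow_zero, pow_one, one_smul,
      Module.End.one_apply, neg_smul, add_assoc, neg_add_eq_sub, add_sub_cancel_right]
    refine Submodule.sum_mem _ fun k _ => Submodule.smul_of_tower_mem _ _ ?_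
    exact degreeLT_mono (by omega) (D.divergence_pow_mem_degreeLT hmem (k + 1 + 1))

theorem symbolMap_half_sub_mem_degreeLT {m : ℕ} {φ : MvPolynomial (Fin n) R}
    (h : φ ∈ degreeLT (Fin n) R m) :
    D.symbolMap (1 / 2 : K) φ - (φ - (1 / 2 : K) • D.divergence φ) ∈
      degreeLT (Fin n) R (m - 2) := by
  rw [← sum_homogeneousComponent_of_mem_degreeLT h]
  simp only [map_sum, Finset.smul_sum, ← Finset.sum_sub_distrib]
  refine Submodule.sum_mem _ fun d hd => degreeLT_mono ?_
    (D.symbolMap_half_sub_mem_degreeLT_of_isHomogeneous (homogeneousComponent_isHomogeneous d φ))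
  have := Finset.mem_range.1 hd
  omega

theorem symbolMap_half_mul_sub_mem_degreeLT {a b : ℕ} {φ ψ : MvPolynomial (Fin n) R}
    (hφ : φ ∈ degreeLT (Fin n) R (a + 1)) (hψ : ψ ∈ degreeLT (Fin n) R (b + 1)) :
    D.symbolMap (1 / 2 : K) φ * D.symbolMap (1 / 2 : K) ψ -
        (φ * ψ - (1 / 2 : K) • (φ * D.divergence ψ + ψ * D.divergence φ)) ∈
      degreeLT (Fin n) R (a + b - 1) := by
  have hS := D.isUnipotent_symbolMap (1 / 2 : K)
  have htrunc : φ - (1 / 2 : K) • D.divergence φ ∈ degreeLT (Fin n) R (a + 1) :=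
    Submodule.sub_mem _ hφ (Submodule.smul_of_tower_mem _ _
      (degreeLT_mono (Nat.sub_le _ _) (D.divergence_mem_degreeLT hφ)))
  have herr := mul_mem_degreeLT_of_mem_degreeLT_sub_one (m := a)
    (degreeLT_mono (by omega) (D.symbolMap_half_sub_mem_degreeLT hφ)) (hS.apply_mem_degreeLT hψ)
  have herr' := mul_mem_degreeLT_of_mem_degreeLT_sub_one (m := b)
    (degreeLT_mono (by omega) (D.symbolMap_half_sub_mem_degreeLT hψ)) htrunc
  have hdiv := Submodule.smul_of_tower_mem _ (1 / 2 * (1 / 2) : K)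
    (mul_mem_degreeLT (D.divergence_mem_degreeLT hφ) (D.divergence_mem_degreeLT hψ))
  have hsum := Submodule.add_mem _ (Submodule.add_mem _
    (degreeLT_mono (by omega : _ ≤ a + b - 1) herr)
    (degreeLT_mono (by omega : _ ≤ a + b - 1) herr')) hdiv
  have hexpand (x y x' y' u v : MvPolynomial (Fin n) R) (c : K) :
      x * y - (x' * y' - c • (x' * v + y' * u)) = (x - (x' - c • u)) * y +
        (y - (y' - c • v)) * (x' - c • u) + (c * c) • (u * v) := by
    simp only [Algebra.smul_def, map_mul]
    ring
  rwa [← hexpand] at hsum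

theorem sub_half_divergence (φ ψ r : MvPolynomial (Fin n) R) :
    φ * ψ + ∑ i, pderiv i φ * D.symbolDer i ψ + r -
        (1 / 2 : K) • D.divergence (φ * ψ + ∑ i, pderiv i φ * D.symbolDer i ψ + r) =
      φ * ψ - (1 / 2 : K) • (φ * D.divergence ψ + ψ * D.divergence φ) +
        (1 / 2 : K) • D.poisson φ ψ + r -
        (1 / 2 : K) • D.divergence (∑ i, pderiv i φ * D.symbolDer i ψ + r) := by
  rw [add_assoc (φ * ψ), map_add D.divergence (φ * ψ), divergence_mul_eq_sub_poisson]
  module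

theorem symbolMap_half_comp_sub_mem_degreeLT {a b : ℕ} {φ ψ r : MvPolynomial (Fin n) R}
    (hφ : φ ∈ degreeLT (Fin n) R (a + 1)) (hψ : ψ ∈ degreeLT (Fin n) R (b + 1))
    (hr : r ∈ degreeLT (Fin n) R (a + b - 1)) :
    D.symbolMap (1 / 2 : K) (φ * ψ + ∑ i, pderiv i φ * D.symbolDer i ψ + r) -
        (D.symbolMap (1 / 2 : K) φ * D.symbolMap (1 / 2 : K) ψ +
          (1 / 2 : K) • D.poisson (D.symbolMap (1 / 2 : K) φ) (D.symbolMap (1 / 2 : K) ψ)) ∈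
      degreeLT (Fin n) R (a + b - 1) := by
  have hS : ∑ i, pderiv i φ * D.symbolDer i ψ ∈ degreeLT (Fin n) R (a + b) :=
    Submodule.sum_mem _ fun i _ => degreeLT_mono (by omega)
      (mul_mem_degreeLT (pderiv_mem_degreeLT hφ i) (D.symbolDer_mem_degreeLT hψ i))
  have hsymbol := D.symbolMap_half_sub_mem_degreeLT (mul_add_sum_mem_degreeLT (D := D) hφ hψ hr)
  rw [sub_half_divergence] at hsymbol
  have hprod := D.symbolMap_half_mul_sub_mem_degreeLT hφ hψ
  have hpoisson := Submodule.smul_of_tower_mem _ (1 / 2 : K)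
    (D.symbolMap_poisson_sub_mem_degreeLT (1 / 2 : K) hφ hψ)
  have hdiv := Submodule.smul_of_tower_mem _ (1 / 2 : K) (D.divergence_mem_degreeLT
    (Submodule.add_mem _ hS (degreeLT_mono (Nat.sub_le _ _) hr)))
  have hsum := Submodule.sub_mem _ (Submodule.sub_mem _ (Submodule.sub_mem _ (Submodule.add_mem _
    (degreeLT_mono (by omega : _ ≤ a + b - 1) hsymbol) hr) hdiv) hprod) hpoisson
  rw [smul_sub] at hsum
  convert hsum using 1
  ring

theorem homogeneousComponent_symbolMap_half_comp {a b : ℕ} {φ ψ r : MvPolynomial (Fin n) R}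
    (hφ : φ ∈ degreeLT (Fin n) R (a + 1)) (hψ : ψ ∈ degreeLT (Fin n) R (b + 1))
    (hr : r ∈ degreeLT (Fin n) R (a + b - 1))
    (hφhom : (D.symbolMap (1 / 2 : K) φ).IsHomogeneous a)
    (hψhom : (D.symbolMap (1 / 2 : K) ψ).IsHomogeneous b) :
    (if 1 ≤ a + b then homogeneousComponent (a + b - 1)
      (D.symbolMap (1 / 2 : K) (φ * ψ + ∑ i, pderiv i φ * D.symbolDer i ψ + r)) else 0) =
      (1 / 2 : K) • D.poisson (D.symbolMap (1 / 2 : K) φ) (D.symbolMap (1 / 2 : K) ψ) := by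
  split_ifs with hab
  · have hrest := homogeneousComponent_eq_zero_of_mem_degreeLT
      (D.symbolMap_half_comp_sub_mem_degreeLT hφ hψ hr) le_rfl
    rw [map_sub, sub_eq_zero] at hrest
    rw [hrest, map_add, homogeneousComponent_of_isHomogeneous (hφhom.mul hψhom),
      if_neg (by omega), zero_add, LinearMap.map_smul_of_tower,
      homogeneousComponent_of_isHomogeneous (D.poisson_isHomogeneous hφhom hψhom), if_pos rfl]
  · obtain ⟨rfl, rfl⟩ : a = 0 ∧ b = 0 := by omega
    rw [D.poisson_of_isHomogeneous_zero hφhom hψhom, smul_zero]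

end HalfDensity

/-! ### Monomials -/

section Monomials

section

variable {K R : Type*} {n : ℕ} [CommRing K] [CommRing R] [Algebra K R]
  (D : CoordinateDerivations K R n)

/-- The derivation of symbols along a coordinate direction of the cotangent bundle: `inl i` is
`∂/∂u_i` and `inr i` is `∂/∂ξ_i`. -/
noncomputable def cotangentDer :
    Fin n ⊕ Fin n → Derivation K (MvPolynomial (Fin n) R) (MvPolynomial (Fin n) R) :=
  Sum.elim D.symbolDer fun i => (pderiv i).restrictScalars K

theorem cotangentDer_inl (i : Fin n) : D.cotangentDer (Sum.inl i) = D.symbolDer i := rfl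

theorem cotangentDer_inr (i : Fin n) (φ : MvPolynomial (Fin n) R) :
    D.cotangentDer (Sum.inr i) φ = pderiv i φ := rfl

theorem pderiv_X_pow (i j : Fin n) (d : ℕ) : pderiv j (X i ^ d : MvPolynomial (Fin n) R) =
    ((if j = i then 1 else 0) * d : K) • X i ^ (d - 1) := by
  rw [Derivation.leibniz_pow, pderiv_X, Pi.single_apply]
  rcases eq_or_ne j i with rfl | hji
  · rw [if_pos rfl, if_pos rfl, one_mul, smul_eq_mul, mul_one, Nat.cast_smul_eq_nsmul]
  · rw [if_neg hji, if_neg hji.symm, zero_mul, zero_smul, smul_zero, smul_zero]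

theorem symbolDer_X_pow (i j : Fin n) (d : ℕ) :
    D.symbolDer j (X i ^ d : MvPolynomial (Fin n) R) = 0 := by
  rw [Derivation.leibniz_pow, symbolDer_X, smul_zero, smul_zero]

theorem exists_foldr_cotangentDer_X_pow (i : Fin n) (β : List (Fin n ⊕ Fin n)) :
    ∃ c : K, ∀ d : ℕ, β.foldr (fun s => D.cotangentDer s) (X i ^ d) =
      (c * d.descFactorial β.length) • X i ^ (d - β.length) := by
  induction β with
  | nil => exact ⟨1, fun d => by simp⟩
  | cons s β ih =>
    obtain ⟨c, hc⟩ := ih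
    rcases s with j | j
    · refine ⟨0, fun d => ?_⟩
      rw [List.foldr_cons, hc, Derivation.map_smul, cotangentDer_inl, symbolDer_X_pow, smul_zero,
        zero_mul, zero_smul]
    · refine ⟨c * if j = i then 1 else 0, fun d => ?_⟩
      rw [List.foldr_cons, hc, Derivation.map_smul, cotangentDer_inr, pderiv_X_pow (K := K),
        smul_smul, List.length_cons, Nat.descFactorial_succ, Nat.sub_sub, Nat.cast_mul]
      congr 1
      ring

theorem symbolDer_coord_pow (i j : Fin n) (a : ℕ) :
    D.symbolDer j (C (D.coord i ^ a)) =
      ((if j = i then 1 else 0) * a : K) • C (D.coord i ^ (a - 1)) := by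
  rw [symbolDer_C, Derivation.leibniz_pow, D.der_coord]
  rcases eq_or_ne j i with rfl | hji
  · rw [if_pos rfl, if_pos rfl, one_mul, smul_eq_mul, mul_one, Nat.cast_smul_eq_nsmul, map_nsmul]
  · rw [if_neg hji, if_neg hji, zero_mul, zero_smul, smul_zero, smul_zero, map_zero]

theorem divergence_coord_pow_mul_X_pow (i : Fin n) (a b : ℕ) :
    D.divergence (C (D.coord i ^ a) * X i ^ b) =
      (a * b : K) • (C (D.coord i ^ (a - 1)) * X i ^ (b - 1)) := by
  have hterm (j : Fin n) : D.symbolDer j (pderiv j (C (D.coord i ^ a) * X i ^ b)) =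
      (if j = i then (a * b : K) else 0) • (C (D.coord i ^ (a - 1)) * X i ^ (b - 1)) := by
    rw [pderiv_C_mul, pderiv_X_pow (K := K), mul_smul_comm, Derivation.map_smul,
      Derivation.leibniz, symbolDer_X_pow, symbolDer_coord_pow, smul_zero, zero_add,
      smul_comm (X i ^ (b - 1)), smul_smul, smul_eq_mul, mul_comm (X i ^ (b - 1))]
    congr 1
    split_ifs <;> ring
  rw [divergence_apply, Finset.sum_congr rfl fun j _ => hterm j, ← Finset.sum_smul,
    Finset.sum_ite_eq' _ _, if_pos (Finset.mem_univ i)]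

theorem divergence_pow_coord_pow_mul_X_pow (i : Fin n) (a b k : ℕ) :
    (D.divergence ^ k) (C (D.coord i ^ a) * X i ^ b) =
      (a.descFactorial k * b.descFactorial k : K) •
        (C (D.coord i ^ (a - k)) * X i ^ (b - k)) := by
  induction k with
  | zero => simp
  | succ k ih =>
    rw [pow_succ', Module.End.mul_apply, ih, map_smul, divergence_coord_pow_mul_X_pow, smul_smul,
      Nat.descFactorial_succ, Nat.descFactorial_succ, Nat.sub_sub, Nat.sub_sub]
    push_cast
    congr 1
    ring

theorem C_mul_X_pow_isHomogeneous (f : R) (i : Fin n) (d : ℕ) :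
    (C f * X i ^ d : MvPolynomial (Fin n) R).IsHomogeneous d := by
  have hmul := (isHomogeneous_C (Fin n) f).mul (isHomogeneous_X_pow i d)
  rwa [zero_add] at hmul

end

variable {K R : Type*} {n : ℕ} [Field K] [CommRing R] [Algebra K R]
  (D : CoordinateDerivations K R n)

theorem symbolMap_X_pow (l : K) (i : Fin n) (d : ℕ) : D.symbolMap l (X i ^ d) = X i ^ d := by
  rw [D.symbolMap_of_isHomogeneous l (isHomogeneous_X_pow i d),
    Finset.sum_eq_single_of_mem 0 (Finset.mem_range.2 d.succ_pos), symbolCoeff_zero, one_smul,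
    pow_zero, Module.End.one_apply]
  intro k _ hk
  have hdiv := D.divergence_pow_coord_pow_mul_X_pow i 0 d k
  rw [Nat.descFactorial_of_lt (Nat.pos_of_ne_zero hk), Nat.cast_zero, zero_mul, zero_smul,
    pow_zero, map_one, one_mul] at hdiv
  rw [hdiv, smul_zero]

theorem homogeneousComponent_symbolMap_coord_pow_mul_X_pow (l : K) (i : Fin n) {p d : ℕ}
    (hp : p ≤ d) :
    homogeneousComponent (d - p) (D.symbolMap l (C (D.coord i ^ p) * X i ^ d)) =
      (symbolCoeff n l p d * (p.factorial * d.descFactorial p)) • X i ^ (d - p) := by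
  rw [D.symbolMap_of_isHomogeneous l (C_mul_X_pow_isHomogeneous _ i d), map_sum,
    Finset.sum_eq_single_of_mem p (Finset.mem_range_succ_iff.2 hp)]
  · rw [divergence_pow_coord_pow_mul_X_pow, smul_smul, LinearMap.map_smul_of_tower,
      homogeneousComponent_of_isHomogeneous (C_mul_X_pow_isHomogeneous _ i (d - p)), if_pos rfl,
      Nat.sub_self, pow_zero, map_one, one_mul, Nat.descFactorial_self]
  · intro k hk hkp
    have hkd := Finset.mem_range_succ_iff.1 hk
    rw [divergence_pow_coord_pow_mul_X_pow, smul_smul, LinearMap.map_smul_of_tower,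
      homogeneousComponent_of_isHomogeneous (C_mul_X_pow_isHomogeneous _ i (d - k)),
      if_neg (by omega), smul_zero]

end Monomials

/-! ### Coefficients that are polynomial in the degree -/

section Polynomiality

variable {K : Type*} {n p : ℕ} [Field K] [CharZero K] {l : K}

theorem prod_X_sub_natCast_dvd {P : Polynomial K} (h : ∀ i < p, P.eval (i : K) = 0) :
    ∏ i ∈ Finset.range p, (Polynomial.X - Polynomial.C (i : K)) ∣ P :=
  Finset.prod_dvd_of_coprime
    (fun _ _ _ _ hij => Polynomial.pairwise_coprime_X_sub_C Nat.cast_injective hij)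
    fun i hi => Polynomial.dvd_iff_isRoot.2 (h i (Finset.mem_range.1 hi))

theorem symbolCoeff_mul_prod (l : K) {d : ℕ} (hd : p ≤ d) :
    symbolCoeff n l p d * p.factorial * ∏ i ∈ Finset.range p, (2 * (d : K) - p - i + n) =
      (-1) ^ p * ∏ i ∈ Finset.range p, ((d : K) - 1 - i + l * (n + 1)) := by
  have hden : ∏ i ∈ Finset.range p, (2 * (d : K) - p - i + n) ≠ 0 := by
    refine Finset.prod_ne_zero_iff.2 fun i hi => ?_
    have hip := Finset.mem_range.1 hi
    have hcast : 2 * (d : K) - p - i + n = ((2 * d - p - i + n : ℕ) : K) := by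
      push_cast [Nat.cast_sub (by omega : p ≤ 2 * d), Nat.cast_sub (by omega : i ≤ 2 * d - p)]
      ring
    exact hcast ▸ Nat.cast_ne_zero.2 (by omega)
  have hfactorial : (p.factorial : K) ≠ 0 := Nat.cast_ne_zero.2 p.factorial_ne_zero
  rw [symbolCoeff, Finset.prod_div_distrib, div_mul_div_comm, mul_assoc,
    div_mul_cancel₀ _ (mul_ne_zero hfactorial hden)]

theorem exists_mul_prod_eq_of_eval_eq_symbolCoeff {P : Polynomial K}
    (hP : ∀ d : ℕ, P.eval (d : K) = symbolCoeff n l p d * (p.factorial * d.descFactorial p)) :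
    ∃ S : Polynomial K,
      S * ∏ i ∈ Finset.range p, (2 * Polynomial.X - Polynomial.C ((p : K) + i - n)) =
        Polynomial.C ((-1) ^ p) *
          ∏ i ∈ Finset.range p, (Polynomial.X - Polynomial.C (1 + (i : K) - l * (n + 1))) := by
  obtain ⟨S, rfl⟩ := prod_X_sub_natCast_dvd fun i hi => by
    rw [hP, Nat.descFactorial_of_lt hi, Nat.cast_zero, mul_zero, mul_zero]
  have hS (d : ℕ) (hd : p ≤ d) : S.eval (d : K) = symbolCoeff n l p d * p.factorial := by
    have hdescFactorial : (d.descFactorial p : K) ≠ 0 :=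
      Nat.cast_ne_zero.2 (Nat.descFactorial_eq_zero_iff_lt.not.2 hd.not_gt)
    refine mul_right_cancel₀ hdescFactorial ?_
    rw [mul_assoc, ← hP d, Polynomial.eval_mul, mul_comm, ← descPochhammer_eval_eq_descFactorial,
      descPochhammer_eval_eq_prod_range, Polynomial.eval_prod]
    simp only [Polynomial.eval_sub, Polynomial.eval_X, Polynomial.eval_C]
  refine ⟨S, Polynomial.eq_of_infinite_eval_eq _ _
    (((Set.Ici_infinite p).image (Nat.cast_injective (R := K)).injOn).mono ?_)⟩
  rintro _ ⟨d, hd : p ≤ d, rfl⟩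
  simp only [Set.mem_ofPred_eq, Polynomial.eval_mul, Polynomial.eval_prod, Polynomial.eval_sub,
    Polynomial.eval_X, Polynomial.eval_C, Polynomial.eval_ofNat, hS d hd]
  convert symbolCoeff_mul_prod (n := n) l hd using 2 <;>
    exact Finset.prod_congr rfl fun i _ => by ring

theorem exists_eq_of_mul_prod_eq {S : Polynomial K}
    (hS : S * ∏ i ∈ Finset.range p, (2 * Polynomial.X - Polynomial.C ((p : K) + i - n)) =
      Polynomial.C ((-1) ^ p) *
        ∏ i ∈ Finset.range p, (Polynomial.X - Polynomial.C (1 + (i : K) - l * (n + 1))))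
    {j : ℕ} (hj : j < p) : ∃ i < p, (p : K) + j - n = 2 * (1 + i - l * (n + 1)) := by
  have heval := congrArg (Polynomial.eval (((p : K) + j - n) / 2)) hS
  simp only [Polynomial.eval_mul, Polynomial.eval_prod, Polynomial.eval_sub, Polynomial.eval_X,
    Polynomial.eval_C, Polynomial.eval_ofNat] at heval
  rw [Finset.prod_eq_zero (Finset.mem_range.2 hj) (by ring), mul_zero, eq_comm, mul_eq_zero,
    or_iff_right (pow_ne_zero _ (neg_ne_zero.2 one_ne_zero)), Finset.prod_eq_zero_iff] at heval
  obtain ⟨i, hi, hroot⟩ := heval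
  exact ⟨i, Finset.mem_range.1 hi, by linear_combination 2 * hroot⟩

-- For `p ≥ 2`, subtracting the equation for `j = 0` from the one for `j = 1` gives `1 = 2 * m`.
theorem eq_half_of_forall_exists_eq (hp : 1 ≤ p)
    (h : ∀ j < p, ∃ i < p, (p : K) + j - n = 2 * (1 + i - l * (n + 1))) :
    l = 1 / 2 ∧ p = 1 := by
  obtain ⟨i, hi, hzero⟩ := h 0 hp
  rcases hp.eq_or_lt with rfl | hp
  · obtain rfl : i = 0 := Nat.lt_one_iff.1 hi
    refine ⟨mul_right_cancel₀ (Nat.cast_add_one_ne_zero n) ?_, rfl⟩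
    push_cast at hzero
    linear_combination (1 / 2) * hzero
  · obtain ⟨j, -, hone⟩ := h 1 hp
    have hparity : ((2 * j : ℕ) : K) = ((2 * i + 1 : ℕ) : K) := by
      push_cast at hzero hone ⊢
      linear_combination hzero - hone
    have := Nat.cast_injective hparity
    omega

theorem eq_half_of_eval_eq_symbolCoeff (hp : 1 ≤ p) {P : Polynomial K}
    (hP : ∀ d : ℕ, P.eval (d : K) = symbolCoeff n l p d * (p.factorial * d.descFactorial p)) :
    l = 1 / 2 ∧ p = 1 := by
  obtain ⟨S, hS⟩ := exists_mul_prod_eq_of_eval_eq_symbolCoeff hP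
  exact eq_half_of_forall_exists_eq hp fun j hj => exists_eq_of_mul_prod_eq hS hj

end Polynomiality

end CoordinateDerivations

/-! ### Smooth functions -/

section Smooth

variable {n : ℕ}

theorem partialU_mul (i : Fin n) (f g : Smooth n) :
    partialU i (f * g) = f * partialU i g + g * partialU i f := by
  refine Subtype.ext <| funext fun u => ?_
  have hmul := fderiv_mul (Smooth.differentiable f u) (Smooth.differentiable g u)
  exact congrArg (fun L => L (Pi.single i 1)) hmul

theorem partialU_comm (i j : Fin n) (f : Smooth n) :
    partialU i (partialU j f) = partialU j (partialU i f) := by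
  refine Subtype.ext <| funext fun u => ?_
  have hsymm : IsSymmSndFDerivAt ℝ f.1 u :=
    (Smooth.contDiff f).contDiffAt.isSymmSndFDerivAt <| by
      rw [minSmoothness_of_isRCLikeNormedField]
      exact WithTop.coe_le_coe.2 (le_top (a := (2 : ℕ∞)))
  have hdiff : DifferentiableAt ℝ (fderiv ℝ f.1) u :=
    ((Smooth.contDiff f).fderiv_right (m := ∞) (by simp)).differentiable (by simp) u
  have hsecond (v w : Fin n → ℝ) :
      fderiv ℝ (fun x => fderiv ℝ f.1 x v) u w = fderiv ℝ (fderiv ℝ f.1) u w v := by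
    simp [fderiv_clm_apply hdiff (differentiableAt_const v)]
  exact (hsecond _ _).trans ((hsymm _ _).trans (hsecond _ _).symm)

theorem partialU_coord (i j : Fin n) : partialU i (coord j) = if i = j then 1 else 0 := by
  refine Subtype.ext <| funext fun u => ?_
  have hcoord := (Complex.ofRealCLM.comp
    (ContinuousLinearMap.proj (R := ℝ) (φ := fun _ : Fin n => ℝ) j)).hasFDerivAt (x := u)
  refine (congrArg (fun L => L (Pi.single i 1)) hcoord.fderiv).trans ?_
  rcases eq_or_ne i j with rfl | hij
  · simp
  · simp [hij]

/-- The algebra of smooth functions on `ℝⁿ` with its coordinates and partial derivatives. -/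
noncomputable def smoothDerivations (n : ℕ) : CoordinateDerivations ℂ (Smooth n) n where
  coord := coord
  der i := Derivation.mk' (partialU i) (partialU_mul i)
  der_comm := partialU_comm
  der_coord := partialU_coord

theorem op_smoothDerivations (φ : Pol n) : (smoothDerivations n).op φ = diffOp φ := by
  conv_lhs => rw [φ.as_sum]
  rw [map_sum]
  simp only [CoordinateDerivations.op_monomial]
  rfl

theorem symbolDer_smoothDerivations (i : Fin n) (φ : Pol n) :
    (smoothDerivations n).symbolDer i φ = Pol.partialU i φ := rfl

theorem poisson_smoothDerivations (φ ψ : Pol n) :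
    (smoothDerivations n).poisson φ ψ = poisson φ ψ := by
  simp only [CoordinateDerivations.poisson_apply, symbolDer_smoothDerivations]
  rfl

theorem momentum_smoothDerivations (η : Fin n → Smooth n) :
    CoordinateDerivations.momentum η = momentum η :=
  CoordinateDerivations.momentum_apply η

theorem projField_smoothDerivations (x : Matrix (Fin (n + 1)) (Fin (n + 1)) ℝ) :
    (smoothDerivations n).projField (x.map (algebraMap ℝ ℂ)) = projField x := rfl

end Smooth

/-! ### Existence and uniqueness of the quantization map -/

section Uniqueness

variable {n : ℕ} {l : ℂ}

theorem isEquivariantQuantization_quantization (n : ℕ) (l : ℂ) :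
    IsEquivariantQuantization n l ((smoothDerivations n).quantization l) where
  injective := (smoothDerivations n).quantization_injective l
  range_eq := by
    have hsurj := ((smoothDerivations n).isUnipotent_symbolMap l).bijective.surjective
    rw [← hsurj.range_comp]
    refine congrArg Set.range (funext fun ψ => ?_)
    rw [Function.comp_apply, CoordinateDerivations.quantization_symbolMap, op_smoothDerivations]
  symbol d φ hφ := by
    obtain ⟨χ, hχ, hop⟩ := (smoothDerivations n).exists_quantization_eq_op_add l hφ
    exact ⟨hφ, χ, mem_degreeLT_iff_support.1 hχ, hop.trans (op_smoothDerivations _)⟩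
  equivariant x _ φ := by
    have hequiv := (smoothDerivations n).apply_poisson_momentum_projField
      ((smoothDerivations n).quantization_glAction l) (x.map (algebraMap ℝ ℂ)) φ
    rwa [poisson_smoothDerivations, momentum_smoothDerivations, projField_smoothDerivations]
      at hequiv

theorem IsEquivariantQuantization.apply_glAction {Q : Pol n →ₗ[ℂ] Module.End ℂ (Smooth n)}
    (hQ : IsEquivariantQuantization n l Q) (k j : Fin (n + 1)) (φ : Pol n) :
    Q ((smoothDerivations n).glAction k j φ) =
      (smoothDerivations n).lieDensity l ((smoothDerivations n).fieldUnit k j) * Q φ -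
        Q φ * (smoothDerivations n).lieDensity l ((smoothDerivations n).fieldUnit k j) := by
  obtain ⟨x, hx, hfield⟩ := CoordinateDerivations.exists_trace_eq_zero_projField_eq (F := ℝ)
    (smoothDerivations n) k j
  have hequiv := hQ.equivariant x hx φ
  rwa [← projField_smoothDerivations, hfield, ← momentum_smoothDerivations,
    ← poisson_smoothDerivations, CoordinateDerivations.poisson_momentum_fieldUnit] at hequiv

theorem IsEquivariantQuantization.eq_quantization {Q : Pol n →ₗ[ℂ] Module.End ℂ (Smooth n)}
    (hQ : IsEquivariantQuantization n l Q) : Q = (smoothDerivations n).quantization l := by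
  refine (smoothDerivations n).eq_quantization (fun d φ hφ => ?_) hQ.apply_glAction
  obtain ⟨-, χ, hχ, hop⟩ := hQ.symbol d φ hφ
  exact ⟨χ, mem_degreeLT_iff_support.2 hχ, hop.trans (op_smoothDerivations _).symm⟩

theorem IsEquivariantQuantization.apply_symbolMap {Q : Pol n →ₗ[ℂ] Module.End ℂ (Smooth n)}
    (hQ : IsEquivariantQuantization n l Q) (ψ : Pol n) :
    Q ((smoothDerivations n).symbolMap l ψ) = (smoothDerivations n).op ψ := by
  rw [hQ.eq_quantization, CoordinateDerivations.quantization_symbolMap]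

end Uniqueness

/-! ### The star product -/

section StarProduct

variable {n : ℕ}

theorem coeff_sum_monomial_homogeneousComponent (Q : Pol n →ₗ[ℂ] Module.End ℂ (Smooth n))
    (k N : ℕ) (χ : Pol n) :
    (∑ d ∈ Finset.range (χ.totalDegree + 1),
      Polynomial.monomial (k + d) (Q (homogeneousComponent d χ))).coeff N =
      if k ≤ N then Q (homogeneousComponent (N - k) χ) else 0 := by
  simp only [Polynomial.finsetSum_coeff, Polynomial.coeff_monomial]
  split_ifs with hk
  · have hindex (d : ℕ) : k + d = N ↔ d = N - k := by omega
    simp only [hindex, Finset.sum_ite_eq', Finset.mem_range]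
    split_ifs with hlt
    · rfl
    · rw [homogeneousComponent_eq_zero_of_mem_degreeLT (mem_degreeLT_totalDegree_add_one χ)
        (not_lt.1 hlt), map_zero]
  · exact Finset.sum_eq_zero fun d _ => if_neg (by omega)

theorem coeff_gradedQ (Q : Pol n →ₗ[ℂ] Module.End ℂ (Smooth n)) (Φ : Polynomial (Pol n)) (N : ℕ) :
    (gradedQ Q Φ).coeff N =
      Q (∑ x ∈ Finset.HasAntidiagonal.antidiagonal N, homogeneousComponent x.2 (Φ.coeff x.1)) := by
  rw [gradedQ, Polynomial.finsetSum_coeff,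
    Finset.sum_congr rfl fun k _ => coeff_sum_monomial_homogeneousComponent Q k N (Φ.coeff k),
    map_sum, Finset.Nat.sum_antidiagonal_eq_sum_range_succ
    (fun i j => Q (homogeneousComponent j (Φ.coeff i))), ← Finset.sum_filter]
  refine Finset.sum_subset (fun k hk => ?_) fun k hk hk' => ?_
  · exact Finset.mem_range_succ_iff.2 (Finset.mem_filter.1 hk).2
  · have hzero : k ∉ Φ.support := fun h =>
      hk' (Finset.mem_filter.2 ⟨h, Finset.mem_range_succ_iff.1 hk⟩)
    rw [Polynomial.notMem_support_iff.1 hzero, map_zero, map_zero]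

/-- The map `gradedQ Q` as a homomorphism of additive monoids. -/
noncomputable def gradedQHom (Q : Pol n →ₗ[ℂ] Module.End ℂ (Smooth n)) :
    Polynomial (Pol n) →+ Polynomial (Module.End ℂ (Smooth n)) where
  toFun := gradedQ Q
  map_zero' := by simp only [gradedQ, Polynomial.support_zero, Finset.sum_empty]
  map_add' Φ Ψ := by
    ext1 N
    simp only [Polynomial.coeff_add, coeff_gradedQ, map_add, Finset.sum_add_distrib]

theorem gradedQ_sum {ι : Type*} (Q : Pol n →ₗ[ℂ] Module.End ℂ (Smooth n)) (s : Finset ι)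
    (Φ : ι → Polynomial (Pol n)) : gradedQ Q (∑ i ∈ s, Φ i) = ∑ i ∈ s, gradedQ Q (Φ i) :=
  map_sum (gradedQHom Q) Φ s

theorem gradedQ_monomial (Q : Pol n →ₗ[ℂ] Module.End ℂ (Smooth n)) (k : ℕ) {d : ℕ} {χ : Pol n}
    (h : χ.IsHomogeneous d) :
    gradedQ Q (Polynomial.monomial k χ) = Polynomial.monomial (k + d) (Q χ) := by
  ext1 N
  have hterm (x : ℕ × ℕ) : homogeneousComponent x.2 ((Polynomial.monomial k χ).coeff x.1) =
      if x = (k, d) then χ else 0 := by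
    rw [Polynomial.coeff_monomial, apply_ite (homogeneousComponent x.2), map_zero,
      homogeneousComponent_of_isHomogeneous h, ← ite_and]
    simp only [Prod.ext_iff, eq_comm]
  rw [coeff_gradedQ, Polynomial.coeff_monomial, Finset.sum_congr rfl fun x _ => hterm x,
    Finset.sum_ite_eq']
  simp only [Finset.HasAntidiagonal.mem_antidiagonal, apply_ite Q, map_zero]

theorem gradedQ_C (Q : Pol n →ₗ[ℂ] Module.End ℂ (Smooth n)) {d : ℕ} {χ : Pol n}
    (h : χ.IsHomogeneous d) : gradedQ Q (Polynomial.C χ) = Polynomial.monomial d (Q χ) := by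
  rw [← Polynomial.monomial_zero_left, gradedQ_monomial Q 0 h, zero_add]

theorem homogeneousComponent_sum_antidiagonal {σ R : Type*} [CommRing R]
    (Φ : Polynomial (MvPolynomial σ R)) (k d : ℕ) :
    homogeneousComponent d
      (∑ x ∈ Finset.HasAntidiagonal.antidiagonal (k + d), homogeneousComponent x.2 (Φ.coeff x.1)) =
        homogeneousComponent d (Φ.coeff k) := by
  simp only [map_sum,
    homogeneousComponent_of_isHomogeneous (homogeneousComponent_isHomogeneous _ _)]
  rw [Finset.sum_eq_single_of_mem (k, d) (Finset.HasAntidiagonal.mem_antidiagonal.2 rfl),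
    if_pos rfl]
  intro x hx hne
  have hsum := Finset.HasAntidiagonal.mem_antidiagonal.1 hx
  exact if_neg fun hd => hne (Prod.ext (by omega) hd.symm)

theorem gradedQ_injective {Q : Pol n →ₗ[ℂ] Module.End ℂ (Smooth n)} (hQ : Function.Injective Q) :
    Function.Injective (gradedQ Q) := fun Φ Ψ h => by
  ext1 k
  ext1 a
  have hcoeff := congrArg (fun P => P.coeff (k + a.degree)) h
  simp only [coeff_gradedQ] at hcoeff
  have hcomponent := congrArg (homogeneousComponent a.degree) (hQ hcoeff)
  rw [homogeneousComponent_sum_antidiagonal, homogeneousComponent_sum_antidiagonal] at hcomponent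
  simpa only [coeff_homogeneousComponent, if_true] using congrArg (coeff a) hcomponent

theorem gradedQ_sum_monomial_homogeneousComponent (Q : Pol n →ₗ[ℂ] Module.End ℂ (Smooth n))
    {a b : ℕ} {φ ψ W : Pol n} (hφ : φ.IsHomogeneous a) (hψ : ψ.IsHomogeneous b)
    (hW : W ∈ degreeLT (Fin n) (Smooth n) (a + b + 1)) (h : Q W = Q φ * Q ψ) :
    gradedQ Q (∑ m ∈ Finset.range (a + b + 1),
      Polynomial.monomial (a + b - m) (homogeneousComponent m W)) =
      gradedQ Q (Polynomial.C φ) * gradedQ Q (Polynomial.C ψ) := by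
  rw [gradedQ_sum, gradedQ_C Q hφ, gradedQ_C Q hψ, Polynomial.monomial_mul_monomial, ← h]
  nth_rewrite 2 [← sum_homogeneousComponent_of_mem_degreeLT hW]
  rw [map_sum, map_sum]
  refine Finset.sum_congr rfl fun m hm => ?_
  rw [gradedQ_monomial Q _ (homogeneousComponent_isHomogeneous m W),
    Nat.sub_add_cancel (Finset.mem_range_succ_iff.1 hm)]

namespace IsEquivariantQuantization

variable {l : ℂ} {Q : Pol n →ₗ[ℂ] Module.End ℂ (Smooth n)}

theorem exists_apply_eq_mul (hQ : IsEquivariantQuantization n l Q) {a b : ℕ} {φ ψ : Pol n}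
    (hφ : φ.IsHomogeneous a) (hψ : ψ.IsHomogeneous b) :
    ∃ W ∈ degreeLT (Fin n) (Smooth n) (a + b + 1), Q W = Q φ * Q ψ := by
  have hunipotent : IsUnipotent ((smoothDerivations n).symbolMap l) :=
    (smoothDerivations n).isUnipotent_symbolMap l
  obtain ⟨φ', hφ', rfl⟩ :=
    hunipotent.exists_mem_degreeLT_apply_eq (mem_degreeLT_of_isHomogeneous hφ)
  obtain ⟨ψ', hψ', rfl⟩ :=
    hunipotent.exists_mem_degreeLT_apply_eq (mem_degreeLT_of_isHomogeneous hψ)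
  obtain ⟨r, hr, hcomp⟩ := CoordinateDerivations.hasFirstOrderComp_of_mem_degreeLT
    (D := smoothDerivations n) hφ' b ψ' hψ'
  refine ⟨_, hunipotent.apply_mem_degreeLT
    (CoordinateDerivations.mul_add_sum_mem_degreeLT (D := smoothDerivations n) hφ' hψ' hr), ?_⟩
  rw [hQ.apply_symbolMap, hQ.apply_symbolMap, hQ.apply_symbolMap, hcomp]

theorem exists_gradedQ_eq_mul (hQ : IsEquivariantQuantization n l Q) (φ ψ : Pol n) :
    ∃ Φ, gradedQ Q Φ = gradedQ Q (Polynomial.C φ) * gradedQ Q (Polynomial.C ψ) := by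
  have hhomogeneous (d e : ℕ) : ∃ Φ, gradedQ Q Φ =
      gradedQ Q (Polynomial.C (homogeneousComponent d φ)) *
        gradedQ Q (Polynomial.C (homogeneousComponent e ψ)) := by
    obtain ⟨W, hW, h⟩ := hQ.exists_apply_eq_mul (homogeneousComponent_isHomogeneous d φ)
      (homogeneousComponent_isHomogeneous e ψ)
    exact ⟨_, gradedQ_sum_monomial_homogeneousComponent Q (homogeneousComponent_isHomogeneous d φ)
      (homogeneousComponent_isHomogeneous e ψ) hW h⟩
  choose F hF using hhomogeneous
  refine ⟨∑ d ∈ Finset.range (φ.totalDegree + 1), ∑ e ∈ Finset.range (ψ.totalDegree + 1), F d e, ?_⟩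
  nth_rewrite 2 [← sum_homogeneousComponent φ]
  nth_rewrite 2 [← sum_homogeneousComponent ψ]
  simp only [map_sum, gradedQ_sum, hF, Finset.sum_mul_sum]

theorem gradedQ_starProduct (hQ : IsEquivariantQuantization n l Q) (φ ψ : Pol n) :
    gradedQ Q (starProduct Q φ ψ) = gradedQ Q (Polynomial.C φ) * gradedQ Q (Polynomial.C ψ) :=
  Function.invFun_eq (hQ.exists_gradedQ_eq_mul φ ψ)

theorem starProduct_eq (hQ : IsEquivariantQuantization n l Q) {φ ψ : Pol n}
    {Φ : Polynomial (Pol n)}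
    (h : gradedQ Q Φ = gradedQ Q (Polynomial.C φ) * gradedQ Q (Polynomial.C ψ)) :
    starProduct Q φ ψ = Φ :=
  gradedQ_injective hQ.injective ((hQ.gradedQ_starProduct φ ψ).trans h.symm)

theorem starCoeff_sum_sum (hQ : IsEquivariantQuantization n l Q) (p : ℕ) {ι κ : Type*}
    (s : Finset ι) (t : Finset κ) (f : ι → Pol n) (g : κ → Pol n) :
    starCoeff Q p (∑ i ∈ s, f i) (∑ j ∈ t, g j) =
      ∑ i ∈ s, ∑ j ∈ t, starCoeff Q p (f i) (g j) := by
  have hsum : starProduct Q (∑ i ∈ s, f i) (∑ j ∈ t, g j) =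
      ∑ i ∈ s, ∑ j ∈ t, starProduct Q (f i) (g j) := by
    apply hQ.starProduct_eq
    simp only [gradedQ_sum, map_sum, hQ.gradedQ_starProduct, Finset.sum_mul_sum]
  simp only [starCoeff, hsum, Polynomial.finsetSum_coeff]

theorem starCoeff_of_isHomogeneous (hQ : IsEquivariantQuantization n l Q) (p : ℕ) {a b : ℕ}
    {φ ψ W : Pol n} (hφ : φ.IsHomogeneous a) (hψ : ψ.IsHomogeneous b)
    (hW : W ∈ degreeLT (Fin n) (Smooth n) (a + b + 1)) (h : Q W = Q φ * Q ψ) :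
    starCoeff Q p φ ψ = if p ≤ a + b then homogeneousComponent (a + b - p) W else 0 := by
  rw [starCoeff, hQ.starProduct_eq (gradedQ_sum_monomial_homogeneousComponent Q hφ hψ hW h)]
  simp only [Polynomial.finsetSum_coeff, Polynomial.coeff_monomial]
  split_ifs with hp
  · rw [Finset.sum_eq_single_of_mem (a + b - p) (Finset.mem_range_succ_iff.2 (Nat.sub_le _ _)),
      if_pos (Nat.sub_sub_self hp)]
    intro m hm hne
    have := Finset.mem_range.1 hm
    exact if_neg (by omega)
  · exact Finset.sum_eq_zero fun m _ => if_neg (by omega)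

end IsEquivariantQuantization

end StarProduct

section HalfDensityStar

variable {n : ℕ} {Q : Pol n →ₗ[ℂ] Module.End ℂ (Smooth n)}

theorem IsEquivariantQuantization.starCoeff_one_of_isHomogeneous
    (hQ : IsEquivariantQuantization n (1 / 2) Q) {a b : ℕ} {φ ψ : Pol n}
    (hφ : φ.IsHomogeneous a) (hψ : ψ.IsHomogeneous b) :
    starCoeff Q 1 φ ψ = (1 / 2 : ℂ) • (smoothDerivations n).poisson φ ψ := by
  have hunipotent : IsUnipotent ((smoothDerivations n).symbolMap (1 / 2)) :=
    (smoothDerivations n).isUnipotent_symbolMap (1 / 2)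
  obtain ⟨φ', hφ', rfl⟩ :=
    hunipotent.exists_mem_degreeLT_apply_eq (mem_degreeLT_of_isHomogeneous hφ)
  obtain ⟨ψ', hψ', rfl⟩ :=
    hunipotent.exists_mem_degreeLT_apply_eq (mem_degreeLT_of_isHomogeneous hψ)
  obtain ⟨r, hr, hcomp⟩ := CoordinateDerivations.hasFirstOrderComp_of_mem_degreeLT
    (D := smoothDerivations n) hφ' b ψ' hψ'
  have hW := hunipotent.apply_mem_degreeLT
    (CoordinateDerivations.mul_add_sum_mem_degreeLT (D := smoothDerivations n) hφ' hψ' hr)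
  rw [hQ.starCoeff_of_isHomogeneous 1 hφ hψ hW (by
    rw [hQ.apply_symbolMap, hQ.apply_symbolMap, hQ.apply_symbolMap, hcomp])]
  exact (smoothDerivations n).homogeneousComponent_symbolMap_half_comp hφ' hψ' hr hφ hψ

theorem IsEquivariantQuantization.starCoeff_one (hQ : IsEquivariantQuantization n (1 / 2) Q)
    (φ ψ : Pol n) : starCoeff Q 1 φ ψ = (1 / 2 : ℂ) • poisson φ ψ := by
  rw [← poisson_smoothDerivations, ← sum_homogeneousComponent φ, ← sum_homogeneousComponent ψ,
    hQ.starCoeff_sum_sum]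
  simp only [map_sum, LinearMap.sum_apply, Finset.smul_sum]
  rw [Finset.sum_comm]
  exact Finset.sum_congr rfl fun e _ => Finset.sum_congr rfl fun d _ =>
    hQ.starCoeff_one_of_isHomogeneous (homogeneousComponent_isHomogeneous d φ)
      (homogeneousComponent_isHomogeneous e ψ)

end HalfDensityStar

/-! ### Symbols as functions on the cotangent bundle -/

section Bidifferential

variable {n : ℕ}

/-- Evaluation of smooth functions at a point, as a ring homomorphism; it exhibits the value of a
symbol at a point of the cotangent bundle as an `MvPolynomial.eval₂`. -/
def evalAt (u : Fin n → ℝ) : Smooth n →+* ℂ :=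
  (Pi.evalRingHom (fun _ => ℂ) u).comp (Smooth n).val.toRingHom

theorem toFunction_eq_eval₂ (φ : Pol n) (z : (Fin n → ℝ) × (Fin n → ℝ)) :
    φ.toFunction z = eval₂ (evalAt z.1) (fun i => (z.2 i : ℂ)) φ := by
  rw [eval₂_eq']
  rfl

theorem toFunction_add (φ ψ : Pol n) :
    (φ + ψ).toFunction = φ.toFunction + ψ.toFunction := by
  funext z
  simp only [toFunction_eq_eval₂, eval₂_add, Pi.add_apply]

theorem toFunction_sub (φ ψ : Pol n) :
    (φ - ψ).toFunction = φ.toFunction - ψ.toFunction :=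
  eq_sub_of_add_eq <| by rw [← toFunction_add, sub_add_cancel]

theorem toFunction_mul (φ ψ : Pol n) :
    (φ * ψ).toFunction = φ.toFunction * ψ.toFunction := by
  funext z
  simp only [toFunction_eq_eval₂, eval₂_mul, Pi.mul_apply]

theorem toFunction_C (f : Smooth n) : Pol.toFunction (C f) = fun z => f.1 z.1 := by
  funext z
  rw [toFunction_eq_eval₂, eval₂_C]
  rfl

theorem toFunction_X (i : Fin n) : Pol.toFunction (X i) = fun z => (z.2 i : ℂ) := by
  funext z
  rw [toFunction_eq_eval₂, eval₂_X]

theorem toFunction_sum {ι : Type*} (s : Finset ι) (φ : ι → Pol n)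
    (z : (Fin n → ℝ) × (Fin n → ℝ)) :
    (∑ i ∈ s, φ i).toFunction z = ∑ i ∈ s, (φ i).toFunction z := by
  simp only [toFunction_eq_eval₂, eval₂_sum]

theorem toFunction_smul (c : ℂ) (φ : Pol n) : (c • φ).toFunction = c • φ.toFunction := by
  rw [Algebra.smul_def, toFunction_mul]
  exact congrArg (· * φ.toFunction) (toFunction_C (algebraMap ℂ (Smooth n) c))

/-- The function of the symbol `φ` is differentiable at `z`, and its derivatives in the coordinate
directions are the values of the formal derivatives of `φ`. -/
def HasFormalFDerivAt (φ : Pol n) (z : (Fin n → ℝ) × (Fin n → ℝ)) : Prop :=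
  ∃ L : (Fin n → ℝ) × (Fin n → ℝ) →L[ℝ] ℂ, HasFDerivAt φ.toFunction L z ∧
    ∀ s, L (direction s) = Pol.toFunction ((smoothDerivations n).cotangentDer s φ) z

theorem hasFormalFDerivAt_C (f : Smooth n) (z : (Fin n → ℝ) × (Fin n → ℝ)) :
    HasFormalFDerivAt (C f) z := by
  refine ⟨(fderiv ℝ f.1 z.1).comp (ContinuousLinearMap.fst ℝ _ _), ?_, ?_⟩
  · rw [toFunction_C]
    exact (Smooth.differentiable f z.1).hasFDerivAt.comp z hasFDerivAt_fst
  · rintro (i | i)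
    · rw [CoordinateDerivations.cotangentDer_inl, CoordinateDerivations.symbolDer_C, toFunction_C]
      rfl
    · rw [CoordinateDerivations.cotangentDer_inr, pderiv_C, ← map_zero C, toFunction_C]
      exact map_zero (fderiv ℝ f.1 z.1)

theorem hasFormalFDerivAt_X (i : Fin n) (z : (Fin n → ℝ) × (Fin n → ℝ)) :
    HasFormalFDerivAt (X i) z := by
  let L : (Fin n → ℝ) × (Fin n → ℝ) →L[ℝ] ℂ :=
    (Complex.ofRealCLM.comp (ContinuousLinearMap.proj i)).comp (ContinuousLinearMap.snd ℝ _ _)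
  refine ⟨L, ?_, ?_⟩
  · rw [toFunction_X]
    exact L.hasFDerivAt
  · rintro (j | j)
    · rw [CoordinateDerivations.cotangentDer_inl, CoordinateDerivations.symbolDer_X, ← map_zero C,
        toFunction_C]
      exact Complex.ofReal_zero
    · rw [CoordinateDerivations.cotangentDer_inr, pderiv_X, Pi.single_apply, ← map_zero C,
        ← map_one C, ← apply_ite C, toFunction_C]
      rcases eq_or_ne j i with rfl | hji
      · simp [L, direction]
      · simp [L, direction, hji.symm]

theorem HasFormalFDerivAt.add {φ ψ : Pol n} {z : (Fin n → ℝ) × (Fin n → ℝ)}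
    (hφ : HasFormalFDerivAt φ z) (hψ : HasFormalFDerivAt ψ z) : HasFormalFDerivAt (φ + ψ) z := by
  obtain ⟨L, hL, hLdir⟩ := hφ
  obtain ⟨M, hM, hMdir⟩ := hψ
  refine ⟨L + M, ?_, fun s => ?_⟩
  · rw [toFunction_add]
    exact hL.add hM
  · rw [add_apply, hLdir, hMdir, map_add, toFunction_add, Pi.add_apply]

theorem HasFormalFDerivAt.mul {φ ψ : Pol n} {z : (Fin n → ℝ) × (Fin n → ℝ)}
    (hφ : HasFormalFDerivAt φ z) (hψ : HasFormalFDerivAt ψ z) : HasFormalFDerivAt (φ * ψ) z := by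
  obtain ⟨L, hL, hLdir⟩ := hφ
  obtain ⟨M, hM, hMdir⟩ := hψ
  refine ⟨φ.toFunction z • M + ψ.toFunction z • L, ?_, fun s => ?_⟩
  · rw [toFunction_mul]
    exact hL.mul hM
  · rw [Derivation.leibniz, toFunction_add, smul_eq_mul, smul_eq_mul, toFunction_mul,
      toFunction_mul, Pi.add_apply, Pi.mul_apply, Pi.mul_apply, ← hLdir, ← hMdir]
    rfl

theorem hasFormalFDerivAt (φ : Pol n) (z : (Fin n → ℝ) × (Fin n → ℝ)) :
    HasFormalFDerivAt φ z := by
  induction φ using MvPolynomial.induction_on with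
  | C f => exact hasFormalFDerivAt_C f z
  | add φ ψ hφ hψ => exact hφ.add hψ
  | mul_X φ i hφ => exact hφ.mul (hasFormalFDerivAt_X i z)

theorem iterPartial_toFunction (α : List (Fin n ⊕ Fin n)) (φ : Pol n) :
    iterPartial α φ.toFunction =
      Pol.toFunction (α.foldr (fun s => (smoothDerivations n).cotangentDer s) φ) := by
  induction α with
  | nil => rfl
  | cons s α ih =>
    funext z
    obtain ⟨L, hL, hLdir⟩ :=
      hasFormalFDerivAt (α.foldr (fun s => (smoothDerivations n).cotangentDer s) φ) z
    rw [iterPartial, ih, List.foldr_cons, ← hLdir]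
    exact congrArg (fun L => L (direction s)) hL.fderiv

theorem iterPartial_singleton_toFunction (s : Fin n ⊕ Fin n) (φ : Pol n) :
    iterPartial [s] φ.toFunction = Pol.toFunction ((smoothDerivations n).cotangentDer s φ) :=
  iterPartial_toFunction [s] φ

theorem poisson_toFunction (φ ψ : Pol n) (z : (Fin n → ℝ) × (Fin n → ℝ)) :
    (poisson φ ψ).toFunction z =
      ∑ i, iterPartial [Sum.inr i] φ.toFunction z * iterPartial [Sum.inl i] ψ.toFunction z -
        ∑ i, iterPartial [Sum.inl i] φ.toFunction z * iterPartial [Sum.inr i] ψ.toFunction z := by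
  simp only [iterPartial_singleton_toFunction]
  rw [← poisson_smoothDerivations, CoordinateDerivations.poisson_apply, toFunction_sum,
    ← Finset.sum_sub_distrib]
  exact Finset.sum_congr rfl fun i _ => by
    rw [toFunction_sub, toFunction_mul, toFunction_mul]
    rfl

theorem isBidifferential_smul_poisson (c : ℂ) :
    IsBidifferential fun φ ψ : Pol n => c • poisson φ ψ := by
  classical
  refine fun z => ⟨Set.univ, isOpen_univ, Set.mem_univ z,
    Finset.univ.image (fun i : Fin n => ([Sum.inr i], [Sum.inl i])) ∪
      Finset.univ.image (fun i : Fin n => ([Sum.inl i], [Sum.inr i])),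
    fun s _ => if s.1.head?.any Sum.isRight then c else -c, fun s _ => contDiffOn_const,
    fun φ ψ y _ => ?_⟩
  have hdisjoint : Disjoint (Finset.univ.image fun i : Fin n => ([Sum.inr i], [Sum.inl i]))
      (Finset.univ.image fun i : Fin n => ([Sum.inl i], [Sum.inr i])) := by
    simp [Finset.disjoint_left]
  rw [Finset.sum_union hdisjoint, Finset.sum_image fun i _ j _ h => by simpa using h,
    Finset.sum_image fun i _ j _ h => by simpa using h, toFunction_smul, Pi.smul_apply,
    poisson_toFunction]
  simp only [List.head?_cons, Option.any_some, Sum.isRight_inl, Sum.isRight_inr, if_true,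
    Bool.false_eq_true, if_false, mul_assoc, ← Finset.mul_sum, smul_eq_mul]
  ring

theorem IsEquivariantQuantization.isBidifferential_starCoeff_one
    {Q : Pol n →ₗ[ℂ] Module.End ℂ (Smooth n)} (hQ : IsEquivariantQuantization n (1 / 2) Q) :
    IsBidifferential (starCoeff Q 1) := by
  rw [funext₂ hQ.starCoeff_one]
  exact isBidifferential_smul_poisson _

end Bidifferential

/-! ### The coefficients on monomials -/

section Exceptional

variable {n : ℕ} {l : ℂ} {Q : Pol n →ₗ[ℂ] Module.End ℂ (Smooth n)}

theorem toFunction_smul_X_pow_one (c : ℂ) (i : Fin n) (d : ℕ) (u : Fin n → ℝ) :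
    Pol.toFunction (c • X i ^ d) (u, 1) = c := by
  rw [toFunction_smul, Pi.smul_apply, toFunction_eq_eval₂, eval₂_pow, eval₂_X]
  simp

theorem exists_polynomial_iterPartial_X_pow (i : Fin n) (β : List (Fin n ⊕ Fin n)) :
    ∃ P : Polynomial ℂ, ∀ d : ℕ,
      iterPartial β (Pol.toFunction (X i ^ d)) (0, 1) = P.eval (d : ℂ) := by
  obtain ⟨c, hc⟩ := (smoothDerivations n).exists_foldr_cotangentDer_X_pow i β
  refine ⟨Polynomial.C c * descPochhammer ℂ β.length, fun d => ?_⟩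
  rw [iterPartial_toFunction, hc, toFunction_smul_X_pow_one, Polynomial.eval_mul,
    Polynomial.eval_C, descPochhammer_eval_eq_descFactorial]

theorem IsEquivariantQuantization.apply_symbolMap_C_mul_X_pow
    (hQ : IsEquivariantQuantization n l Q) (f : Smooth n) (i : Fin n) (d : ℕ) :
    Q ((smoothDerivations n).symbolMap l (C f * X i ^ d)) = Q (C f) * Q (X i ^ d) := by
  have hf := hQ.apply_symbolMap (C f)
  have hX := hQ.apply_symbolMap (X i ^ d)
  rw [CoordinateDerivations.symbolMap_of_isHomogeneous_zero _ l (isHomogeneous_C _ f)] at hf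
  rw [CoordinateDerivations.symbolMap_X_pow] at hX
  rw [hQ.apply_symbolMap, hf, hX, CoordinateDerivations.op_C_mul, CoordinateDerivations.op_C]
  rfl

theorem IsEquivariantQuantization.starCoeff_coord_pow_X_pow
    (hQ : IsEquivariantQuantization n l Q) (i : Fin n) (p d : ℕ) :
    starCoeff Q p (C (coord i ^ p)) (X i ^ d) =
      (CoordinateDerivations.symbolCoeff n l p d * (p.factorial * d.descFactorial p)) •
        X i ^ (d - p) := by
  have hmem := ((smoothDerivations n).isUnipotent_symbolMap l).apply_mem_degreeLT
    (mem_degreeLT_of_isHomogeneous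
      (CoordinateDerivations.C_mul_X_pow_isHomogeneous (coord i ^ p) i d))
  rw [hQ.starCoeff_of_isHomogeneous p (isHomogeneous_C (Fin n) _) (isHomogeneous_X_pow i d)
    (degreeLT_mono (by omega) hmem) (hQ.apply_symbolMap_C_mul_X_pow _ i d), zero_add]
  split_ifs with hpd
  · exact (smoothDerivations n).homogeneousComponent_symbolMap_coord_pow_mul_X_pow l i hpd
  · rw [Nat.descFactorial_of_lt (not_le.1 hpd), Nat.cast_zero, mul_zero, mul_zero, zero_smul]

theorem IsEquivariantQuantization.eq_half_of_isBidifferential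
    (hQ : IsEquivariantQuantization n l Q) (hn : 1 ≤ n) {p : ℕ} (hp : 1 ≤ p)
    (h : IsBidifferential (starCoeff Q p)) : l = 1 / 2 ∧ p = 1 := by
  obtain ⟨U, -, hU, S, c, -, hB⟩ := h (0, 1)
  let i : Fin n := ⟨0, hn⟩
  choose R hR using exists_polynomial_iterPartial_X_pow i
  let P : Polynomial ℂ := ∑ s ∈ S,
    Polynomial.C (c s (0, 1) * iterPartial s.1 (Pol.toFunction (C (coord i ^ p))) (0, 1)) * R s.2
  refine CoordinateDerivations.eq_half_of_eval_eq_symbolCoeff (n := n) (P := P) hp fun d => ?_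
  have hvalue := hB (C (coord i ^ p)) (X i ^ d) (0, 1) hU
  rw [hQ.starCoeff_coord_pow_X_pow, toFunction_smul_X_pow_one] at hvalue
  simp only [P, hvalue, Polynomial.eval_finsetSum, Polynomial.eval_mul, Polynomial.eval_C, hR]

end Exceptional

end LecomteOvsienko

theorem corollary4 (n : ℕ) (hn : 1 ≤ n) :
    -- the quantization map exists and is unique
    (∀ l : ℂ, ∃! Q : LecomteOvsienko.Pol n →ₗ[ℂ] Module.End ℂ (LecomteOvsienko.Smooth n),
      LecomteOvsienko.IsEquivariantQuantization n l Q) ∧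
    ∀ (l : ℂ) (Q : LecomteOvsienko.Pol n →ₗ[ℂ] Module.End ℂ (LecomteOvsienko.Smooth n)),
      LecomteOvsienko.IsEquivariantQuantization n l Q →
      -- the star product is well defined
      (∀ φ ψ : LecomteOvsienko.Pol n, ∃! Φ : Polynomial (LecomteOvsienko.Pol n),
        LecomteOvsienko.gradedQ Q Φ = LecomteOvsienko.gradedQ Q (Polynomial.C φ) *
          LecomteOvsienko.gradedQ Q (Polynomial.C ψ)) ∧
      -- no coefficient is bidifferential, with one exception
      (∀ p : ℕ, 1 ≤ p →
        (LecomteOvsienko.IsBidifferential (LecomteOvsienko.starCoeff Q p) ↔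
          l = 1 / 2 ∧ p = 1)) ∧
      -- the exception is half of the Poisson bracket
      (l = 1 / 2 → ∀ φ ψ : LecomteOvsienko.Pol n,
        (2 : ℂ) • LecomteOvsienko.starCoeff Q 1 φ ψ = LecomteOvsienko.poisson φ ψ) := by
  refine ⟨fun l => ⟨_, LecomteOvsienko.isEquivariantQuantization_quantization n l,
    fun Q hQ => hQ.eq_quantization⟩, fun l Q hQ => ⟨fun φ ψ => ?_, fun p hp => ⟨?_, ?_⟩, ?_⟩⟩
  · obtain ⟨Φ, hΦ⟩ := hQ.exists_gradedQ_eq_mul φ ψ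
    exact ⟨Φ, hΦ, fun Ψ hΨ => LecomteOvsienko.gradedQ_injective hQ.injective (hΨ.trans hΦ.symm)⟩
  · exact hQ.eq_half_of_isBidifferential hn hp
  · rintro ⟨rfl, rfl⟩
    exact hQ.isBidifferential_starCoeff_one
  · rintro rfl φ ψ
    rw [hQ.starCoeff_one, smul_smul, mul_one_div_cancel two_ne_zero, one_smul]
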